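/- Let $1<\alpha<2$ be such that $1724-2\alpha-570\alpha^2-30\alpha^3+30\alpha^4\neq 0$, and put $$\gamma_1=\frac{350+331\alpha-15\alpha^2-75\alpha^3-15\alpha^4}{1724-2\alpha-570\alpha^2-30\alpha^3+30\alpha^4},\qquad \gamma_2=\frac{566-329\alpha-135\alpha^2+105\alpha^3-15\alpha^4}{1724-2\alpha-570\alpha^2-30\alpha^3+30\alpha^4},$$ $$\mu_1=\frac{566+329\alpha-135\alpha^2-105\alpha^3-15\alpha^4}{1724-2\alpha-570\alpha^2-30\alpha^3+30\alpha^4},\qquad \mu_0=\frac{862+\alpha-285\alpha^2+15\alpha^3+15\alpha^4}{862-\alpha-285\alpha^2-15\alpha^3+15\alpha^4},$$ $$\mu_{-1}=\frac{350-331\alpha-15\alpha^2+75\alpha^3-15\alpha^4}{1724-2\alpha-570\alpha^2-30\alpha^3+30\alpha^4}.$$ (i) Let $a_{p,l}$ denote the coefficient of $z^l$ in the power series expansion at $0$ of $\left(\frac{1-e^{-z}}{z}\right)^{\alpha}e^{pz}$. Then $(\gamma_1,\gamma_2,\mu_1,\mu_0,\mu_{-1})$ is the unique real solution of the linear system $$\mu_1+\mu_0+\mu_{-1}-\gamma_1-\gamma_2=1,$$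 $$\mu_1a_{1,l}+\mu_0a_{0,l}+\mu_{-1}a_{-1,l}-\frac{(-1)^l}{l!}\gamma_1-\frac{1}{l!}\gamma_2=0,\qquad l=1,2,3,4.$$ (ii) Let $u\in C^8(\mathbb R)$ be real-valued with $u^{(k)}\in L^1(\mathbb R)$ for $k=0,1,\dots,8$. Let $$D^\alpha u(x)=\frac{1}{\Gamma(2-\alpha)}\frac{d^2}{dx^2}\int_{-\infty}^x (x-s)^{1-\alpha}u(s)\,ds$$ be the left Riemann--Liouville derivative with lower terminal $-\infty$, and, for $h>0$ and $p\in\mathbb Z$, let $$\Delta_p^\alpha u(x)=\frac1{h^\alpha}\sum_{k=0}^\infty g_k^{(\alpha)}\,u(x-(k-p)h),\qquad g_k^{(\alpha)}=\frac{\Gamma(k-\alpha)}{\Gamma(-\alpha)\Gamma(k+1)},$$ be the shifted Grünwald--Letnikov operator. Then $D^\alpha u$ and $\Delta_p^\alpha u$ are well defined everywhere on $\mathbb R$ (the integral converges absolutely for every $x$ and is a $C^2$ function of $x$, and the series converges absolutely for all $h>0$, $p\in\mathbb Z$, $x\in\mathbb R$), and $$\gamma_1D^\alpha u(x-h)+D^\alpha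 u(x)+\gamma_2D^\alpha u(x+h)=\mu_1\Delta_1^\alpha u(x)+\mu_0\Delta_0^\alpha u(x)+\mu_{-1}\Delta_{-1}^\alpha u(x)+O(h^5)$$ as $h\to0^+$, uniformly in $x\in\mathbb R$. -/

import Mathlib

open MeasureTheory Set

noncomputable section

namespace FifthOrderCWSGD

/-- The integral `∫_{-∞}^x (x - s)^(n - α - 1) u(s) ds` with `n = ⌈α⌉`, so `n - 1 < α < n` for
non-integer `α > 0`. -/
def leftRLIntegral (α : ℝ) (u : ℝ → ℝ) (x : ℝ) : ℝ :=
  ∫ s in Iio x, (x - s) ^ ((⌈α⌉₊ : ℝ) - α - 1) * u s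

/-- The left Riemann-Liouville derivative of order `α` (non-integer, positive) with lower
terminal `-∞`. -/
def leftRL (α : ℝ) (u : ℝ → ℝ) (x : ℝ) : ℝ :=
  1 / Real.Gamma ((⌈α⌉₊ : ℝ) - α) * iteratedDeriv ⌈α⌉₊ (leftRLIntegral α u) x

/-- The Grünwald weights `g_k = Γ(k - α) / (Γ(-α) Γ(k + 1))`. -/
def grunwaldWeight (α : ℝ) (k : ℕ) : ℝ :=
  Real.Gamma ((k : ℝ) - α) / (Real.Gamma (-α) * Real.Gamma ((k : ℝ) + 1))

/-- The `k`-th term `g_k u(x - (k - p) h)` of the shifted Grünwald-Letnikov series. -/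
def grunwaldTerm (α h : ℝ) (p : ℤ) (u : ℝ → ℝ) (x : ℝ) (k : ℕ) : ℝ :=
  grunwaldWeight α k * u (x - ((k : ℝ) - (p : ℝ)) * h)

/-- The left shifted Grünwald-Letnikov operator `Δ_p^α` with step size `h`. -/
def shiftedGrunwald (α h : ℝ) (p : ℤ) (u : ℝ → ℝ) (x : ℝ) : ℝ :=
  1 / h ^ α * ∑' k : ℕ, grunwaldTerm α h p u x k

/-- The function `((1 - e^(-z)) / z)^α e^(p z)`, with its limit value `1` at `z = 0`.
The base of the power is positive for every real `z`. -/
def expansionFunction (α : ℝ) (p : ℤ) (z : ℝ) : ℝ :=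
  (if z = 0 then 1 else (1 - Real.exp (-z)) / z) ^ α * Real.exp ((p : ℝ) * z)

/-- The coefficient `a_{p,l}` of `z^l` in the power series of `((1 - e^(-z)) / z)^α e^(p z)`. -/
def expansionCoeff (α : ℝ) (p : ℤ) (l : ℕ) : ℝ :=
  iteratedDeriv l (expansionFunction α p) 0 / (l.factorial : ℝ)

/-- The five linear equations for the weights `g₁, g₂` (of the derivative at `x - h`, `x + h`)
and `m₁, m₀, m₂` (of the operators with shifts `1, 0, -1`). -/
def CoefficientSystem (α g₁ g₂ m₁ m₀ m₂ : ℝ) : Prop :=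
  m₁ + m₀ + m₂ - g₁ - g₂ = 1 ∧
  m₁ * expansionCoeff α 1 1 + m₀ * expansionCoeff α 0 1 + m₂ * expansionCoeff α (-1) 1
    + g₁ - g₂ = 0 ∧
  m₁ * expansionCoeff α 1 2 + m₀ * expansionCoeff α 0 2 + m₂ * expansionCoeff α (-1) 2
    - g₁ / 2 - g₂ / 2 = 0 ∧
  m₁ * expansionCoeff α 1 3 + m₀ * expansionCoeff α 0 3 + m₂ * expansionCoeff α (-1) 3
    + g₁ / 6 - g₂ / 6 = 0 ∧
  m₁ * expansionCoeff α 1 4 + m₀ * expansionCoeff α 0 4 + m₂ * expansionCoeff α (-1) 4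
    - g₁ / 24 - g₂ / 24 = 0

/-- The common denominator of the coefficients. -/
def denom (α : ℝ) : ℝ := 1724 - 2 * α - 570 * α ^ 2 - 30 * α ^ 3 + 30 * α ^ 4

def gammaOne (α : ℝ) : ℝ :=
  (350 + 331 * α - 15 * α ^ 2 - 75 * α ^ 3 - 15 * α ^ 4) / denom α

def gammaTwo (α : ℝ) : ℝ :=
  (566 - 329 * α - 135 * α ^ 2 + 105 * α ^ 3 - 15 * α ^ 4) / denom α

def muOne (α : ℝ) : ℝ :=
  (566 + 329 * α - 135 * α ^ 2 - 105 * α ^ 3 - 15 * α ^ 4) / denom α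

def muZero (α : ℝ) : ℝ :=
  (862 + α - 285 * α ^ 2 + 15 * α ^ 3 + 15 * α ^ 4) /
    (862 - α - 285 * α ^ 2 - 15 * α ^ 3 + 15 * α ^ 4)

def muNegOne (α : ℝ) : ℝ :=
  (350 - 331 * α - 15 * α ^ 2 + 75 * α ^ 3 - 15 * α ^ 4) / denom α

/-- The 5-CWSGD operator applied to a function `v`:
`γ₁ v(x - h) + v(x) + γ₂ v(x + h)`. -/
def fiveCWSGD (α h : ℝ) (v : ℝ → ℝ) (x : ℝ) : ℝ :=
  gammaOne α * v (x - h) + v x + gammaTwo α * v (x + h)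

end FifthOrderCWSGD

end

/-!
On `e^(z x)` with `z` imaginary the Riemann-Liouville derivative acts as multiplication by `z^α`,
and the operator `Δ_p^α` with step size `h` as multiplication by
`h^(-α) (1 - e^(-z h))^α e^(p z h)`. The error of the scheme therefore multiplies `e^(z x)` by
`h^(-α) σ(z h)`, where `σ(z)` is `z^α` times a function analytic at `0`. The linear system says
exactly that this function vanishes to order `5`, so that `|σ(z)| ≤ C |z|^(5 + α)` on the imaginary
axis. Writing `u` as an inverse Fourier integral, the error is at most `C h^5` times the moment of
order `5 + α` of the Fourier transform of `u`, which is finite because `u` has sufficiently many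
integrable derivatives.

For the uniqueness, let `(γ₁, γ₂, μ₁, μ₀, μ₋₁)` solve the homogeneous system, so that
`∑ μ_p b(z)^α e^(p z) - γ₁ e^(-z) - γ₂ e^z` vanishes to order `5` at `0`, where
`b(z) = (1 - e^(-z)) / z`. After multiplication by `b(z)^(-α)` the weights `μ_p` only have the
coefficients of `e^(p z)`; eliminating them leaves two equations for `γ₁` and `γ₂`, whose
determinant is `α^2 / 1920` times the common denominator.
-/

noncomputable section

namespace FifthOrderCWSGD

open Filter Topology Asymptotics

section TaylorCoefficients

lemma iteratedDeriv_succ_id_mul_zero {𝕜 : Type*} [NontriviallyNormedField 𝕜] {b : 𝕜 → 𝕜} {n : ℕ}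
    (hb : ContDiffAt 𝕜 (n + 1 : ℕ) b 0) :
    iteratedDeriv (n + 1) (fun z => z * b z) 0 = (n + 1) * iteratedDeriv n b 0 := by
  rw [iteratedDeriv_fun_mul (f := fun z : 𝕜 => z) contDiffAt_id hb, Finset.sum_eq_single 1]
  · simp [iteratedDeriv_one]
  · intro i _ hi
    simp [iteratedDeriv_fun_id_zero, hi]
  · simp

lemma sum_choose_mul_iteratedDeriv_of_ode {𝕜 : Type*} [NontriviallyNormedField 𝕜]
    [CompleteSpace 𝕜] {b c f : 𝕜 → 𝕜} {x : 𝕜} (hb : AnalyticAt 𝕜 b x) (hc : AnalyticAt 𝕜 c x)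
    (hf : AnalyticAt 𝕜 f x) (hode : ∀ᶠ z in 𝓝 x, b z * deriv f z = c z * f z) (n : ℕ) :
    ∑ i ∈ Finset.range (n + 1), n.choose i * iteratedDeriv i b x * iteratedDeriv (n - i + 1) f x =
      ∑ i ∈ Finset.range (n + 1), n.choose i * iteratedDeriv i c x * iteratedDeriv (n - i) f x := by
  simpa only [iteratedDeriv_succ', iteratedDeriv_fun_mul hb.contDiffAt hf.deriv.contDiffAt,
    iteratedDeriv_fun_mul hc.contDiffAt hf.contDiffAt] using EventuallyEq.iteratedDeriv_eq n hode

lemma iteratedDeriv_ofReal_of_eventuallyEq {F : ℂ → ℂ} {f : ℝ → ℝ} {x : ℝ}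
    (hF : AnalyticAt ℂ F x) (hFf : ∀ᶠ y : ℝ in 𝓝 x, F y = f y) (n : ℕ) :
    iteratedDeriv n F x = iteratedDeriv n f x := by
  suffices ∀ᶠ y : ℝ in 𝓝 x, iteratedDeriv n F y = iteratedDeriv n f y from this.self_of_nhds
  induction n with
  | zero => simpa only [iteratedDeriv_zero] using hFf
  | succ n ih =>
    have hFn : ∀ᶠ y : ℝ in 𝓝 x, AnalyticAt ℂ F y :=
      Complex.continuous_ofReal.continuousAt.eventually hF.eventually_analyticAt
    filter_upwards [hFn, eventually_eventually_nhds.mpr ih] with y hy hyn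
    have hd : HasDerivAt (iteratedDeriv n F) (iteratedDeriv (n + 1) F y) y := by
      rw [iteratedDeriv_succ, iteratedDeriv_eq_iterate]
      exact (hy.iterated_deriv n).differentiableAt.hasDerivAt
    have hre : HasDerivAt (iteratedDeriv n f) (iteratedDeriv (n + 1) F y).re y :=
      hd.real_of_complex.congr_of_eventuallyEq (hyn.mono fun t ht => by simp [ht])
    rw [iteratedDeriv_succ (f := f), hre.deriv]
    exact hd.comp_ofReal.unique (hre.ofReal_comp.congr_of_eventuallyEq hyn)

/-- The entire function `(1 - e^(-z)) / z`, with value `1` at `z = 0`. -/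
def expQuotient : ℂ → ℂ := dslope (fun z => 1 - Complex.exp (-z)) 0

lemma mul_expQuotient (z : ℂ) : z * expQuotient z = 1 - Complex.exp (-z) := by
  simpa [expQuotient] using sub_smul_dslope (fun z : ℂ => 1 - Complex.exp (-z)) 0 z

lemma expQuotient_zero : expQuotient 0 = 1 := by
  have h : HasDerivAt (fun z : ℂ => 1 - Complex.exp (-z)) 1 0 := by
    simpa using ((hasDerivAt_neg (0 : ℂ)).cexp).const_sub 1
  rw [expQuotient, dslope_same, h.deriv]

lemma expQuotient_ofReal (x : ℝ) :
    expQuotient x = (if x = 0 then 1 else (1 - Real.exp (-x)) / x : ℝ) := by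
  split_ifs with hx
  · simp [hx, expQuotient_zero]
  · push_cast
    rw [eq_div_iff (Complex.ofReal_ne_zero.mpr hx), mul_comm, mul_expQuotient]

lemma one_sub_exp_neg_div_pos (x : ℝ) : 0 < if x = 0 then 1 else (1 - Real.exp (-x)) / x := by
  split_ifs with hx
  · exact one_pos
  rcases lt_or_gt_of_ne hx with hx | hx
  · exact div_pos_of_neg_of_neg (by simpa using hx) hx
  · exact div_pos (by simpa using hx) hx

lemma analyticAt_expQuotient (z : ℂ) : AnalyticAt ℂ expQuotient z := by
  refine Differentiable.analyticAt (differentiableOn_univ.mp ?_) z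
  exact (Complex.differentiableOn_dslope univ_mem).mpr (by fun_prop)

lemma iteratedDeriv_expQuotient_zero (n : ℕ) :
    iteratedDeriv n expQuotient 0 = (-1) ^ n / (n + 1) := by
  have h := iteratedDeriv_succ_id_mul_zero (n := n) (analyticAt_expQuotient 0).contDiffAt
  have hexp : iteratedDeriv (n + 1) (fun z : ℂ => Complex.exp (-z)) 0 = (-1) ^ (n + 1) := by
    simpa using congrFun (iteratedDeriv_cexp_const_mul (n + 1) (-1)) 0
  simp only [mul_expQuotient] at h
  rw [iteratedDeriv_fun_sub contDiffAt_const (by fun_prop), hexp, iteratedDeriv_const,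
    if_neg n.succ_ne_zero] at h
  rw [eq_div_iff n.cast_add_one_ne_zero, mul_comm, ← h]
  ring

/-- The function `((1 - e^(-z)) / z)^α e^(p z)` on `ℂ`, with the principal branch of the power;
it extends `expansionFunction` and makes sense on the imaginary axis. -/
def complexExpansion (α p z : ℂ) : ℂ := expQuotient z ^ α * Complex.exp (p * z)

lemma complexExpansion_ofReal (α : ℝ) (p : ℤ) (x : ℝ) :
    complexExpansion α p x = expansionFunction α p x := by
  rw [complexExpansion, expQuotient_ofReal, ← Complex.ofReal_cpow (one_sub_exp_neg_div_pos x).le,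
    expansionFunction]
  push_cast
  rfl

lemma analyticAt_complexExpansion (α p : ℂ) : AnalyticAt ℂ (complexExpansion α p) 0 := by
  unfold complexExpansion
  refine ((analyticAt_expQuotient 0).cpow analyticAt_const ?_).mul (by fun_prop)
  simp [expQuotient_zero]

lemma expQuotient_mul_deriv_complexExpansion (α p : ℂ) :
    ∀ᶠ z in 𝓝 (0 : ℂ), expQuotient z * deriv (complexExpansion α p) z =
      (α * deriv expQuotient z + p * expQuotient z) * complexExpansion α p z := by
  have hslit : ∀ᶠ z in 𝓝 (0 : ℂ), expQuotient z ∈ Complex.slitPlane :=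
    (analyticAt_expQuotient 0).continuousAt.eventually_mem
      (Complex.isOpen_slitPlane.mem_nhds (by simp [expQuotient_zero]))
  filter_upwards [hslit] with z hz
  have hderiv : HasDerivAt (complexExpansion α p) _ z :=
    ((analyticAt_expQuotient z).differentiableAt.hasDerivAt.cpow_const (c := α) hz).mul
      ((hasDerivAt_id z).const_mul p).cexp
  have hne : expQuotient z ≠ 0 := Complex.slitPlane_ne_zero hz
  rw [hderiv.deriv, complexExpansion, Complex.cpow_sub _ _ hne, Complex.cpow_one]
  simp only [id]
  field_simp

lemma sum_choose_mul_iteratedDeriv_complexExpansion (α p : ℂ) (n : ℕ) :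
    ∑ i ∈ Finset.range (n + 1), n.choose i * ((-1) ^ i / (i + 1)) *
        iteratedDeriv (n - i + 1) (complexExpansion α p) 0 =
      ∑ i ∈ Finset.range (n + 1), n.choose i *
        (α * ((-1) ^ (i + 1) / (i + 2)) + p * ((-1) ^ i / (i + 1))) *
          iteratedDeriv (n - i) (complexExpansion α p) 0 := by
  have hb := analyticAt_expQuotient 0
  have hc (i : ℕ) : iteratedDeriv i (fun z => α * deriv expQuotient z + p * expQuotient z) 0 =
      α * ((-1) ^ (i + 1) / (i + 2)) + p * ((-1) ^ i / (i + 1)) := by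
    rw [iteratedDeriv_fun_add (contDiffAt_const.mul hb.deriv.contDiffAt)
        (contDiffAt_const.mul hb.contDiffAt), iteratedDeriv_const_mul_field,
      iteratedDeriv_const_mul_field, ← iteratedDeriv_succ', iteratedDeriv_expQuotient_zero,
      iteratedDeriv_expQuotient_zero]
    push_cast
    ring
  simpa only [iteratedDeriv_expQuotient_zero, hc] using
    sum_choose_mul_iteratedDeriv_of_ode hb (by fun_prop) (analyticAt_complexExpansion α p)
      (expQuotient_mul_deriv_complexExpansion α p) n

lemma iteratedDeriv_complexExpansion (α : ℝ) (p : ℤ) (l : ℕ) :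
    iteratedDeriv l (complexExpansion α p) 0 = l.factorial * expansionCoeff α p l := by
  rw [expansionCoeff, Complex.ofReal_div, Complex.ofReal_natCast, mul_div_cancel₀ _
    (Nat.cast_ne_zero.mpr l.factorial_ne_zero)]
  simpa using iteratedDeriv_ofReal_of_eventuallyEq (x := 0) (by
    simpa using analyticAt_complexExpansion α p)
    (Eventually.of_forall (complexExpansion_ofReal α p)) l

lemma sum_choose_mul_expansionCoeff (α : ℝ) (p : ℤ) (n : ℕ) :
    ∑ i ∈ Finset.range (n + 1), n.choose i * ((-1) ^ i / (i + 1)) *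
        ((n - i + 1).factorial * expansionCoeff α p (n - i + 1)) =
      ∑ i ∈ Finset.range (n + 1), n.choose i *
        (α * ((-1) ^ (i + 1) / (i + 2)) + p * ((-1) ^ i / (i + 1))) *
          ((n - i).factorial * expansionCoeff α p (n - i)) := by
  have h := sum_choose_mul_iteratedDeriv_complexExpansion α p n
  simp only [iteratedDeriv_complexExpansion] at h
  exact_mod_cast h

lemma expansionCoeff_zero (α : ℝ) (p : ℤ) : expansionCoeff α p 0 = 1 := by
  simp [expansionCoeff, expansionFunction]

/- The values below are the coefficients of `e^((p - α / 2) z) (sinh (z / 2) / (z / 2))^α`. -/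
lemma expansionCoeff_one (α : ℝ) (p : ℤ) : expansionCoeff α p 1 = p - α / 2 := by
  have h := sum_choose_mul_expansionCoeff α p 0
  norm_num [Finset.sum_range_succ, expansionCoeff_zero] at h
  linear_combination h

lemma expansionCoeff_two (α : ℝ) (p : ℤ) :
    expansionCoeff α p 2 = (p - α / 2) ^ 2 / 2 + α / 24 := by
  have h := sum_choose_mul_expansionCoeff α p 1
  norm_num [Finset.sum_range_succ, expansionCoeff_zero, expansionCoeff_one] at h
  linear_combination h / 2

lemma expansionCoeff_three (α : ℝ) (p : ℤ) :
    expansionCoeff α p 3 = (p - α / 2) ^ 3 / 6 + (p - α / 2) * α / 24 := by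
  have h := sum_choose_mul_expansionCoeff α p 2
  norm_num [Finset.sum_range_succ, Nat.factorial, Nat.choose, expansionCoeff_zero,
    expansionCoeff_one, expansionCoeff_two] at h
  linear_combination h / 6

lemma expansionCoeff_four (α : ℝ) (p : ℤ) :
    expansionCoeff α p 4 =
      (p - α / 2) ^ 4 / 24 + (p - α / 2) ^ 2 * α / 48 + α ^ 2 / 1152 - α / 2880 := by
  have h := sum_choose_mul_expansionCoeff α p 3
  norm_num [Finset.sum_range_succ, Nat.factorial, Nat.choose, expansionCoeff_zero,
    expansionCoeff_one, expansionCoeff_two, expansionCoeff_three] at h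
  linear_combination h / 24

end TaylorCoefficients

section CoefficientSystem

lemma expansionCoeff_zero_left (p : ℤ) (l : ℕ) :
    expansionCoeff 0 p l = (p : ℝ) ^ l / l.factorial := by
  have h : expansionFunction 0 p = fun x => Real.exp (p * x) := by
    ext x
    simp [expansionFunction]
  rw [expansionCoeff, h, iteratedDeriv_exp_const_mul]
  simp

lemma complexExpansion_add (α β p r : ℂ) :
    ∀ᶠ z in 𝓝 (0 : ℂ), complexExpansion (α + β) (p + r) z =
      complexExpansion α p z * complexExpansion β r z := by
  filter_upwards [(analyticAt_expQuotient 0).continuousAt.eventually_ne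
    (by simp [expQuotient_zero] : expQuotient 0 ≠ 0)] with z hz
  simp only [complexExpansion, Complex.cpow_add _ _ hz, add_mul, Complex.exp_add]
  ring

lemma expansionCoeff_add (α β : ℝ) (p r : ℤ) (l : ℕ) :
    expansionCoeff (α + β) (p + r) l =
      ∑ i ∈ Finset.range (l + 1), expansionCoeff α p i * expansionCoeff β r (l - i) := by
  have hl : (l.factorial : ℂ) ≠ 0 := Nat.cast_ne_zero.mpr l.factorial_ne_zero
  have h := iteratedDeriv_complexExpansion (α + β) (p + r) l
  push_cast at h
  rw [EventuallyEq.iteratedDeriv_eq l (complexExpansion_add α β p r),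
    iteratedDeriv_fun_mul (analyticAt_complexExpansion α p).contDiffAt
      (analyticAt_complexExpansion β r).contDiffAt] at h
  have key : (expansionCoeff (α + β) (p + r) l : ℂ) =
      ∑ i ∈ Finset.range (l + 1), (expansionCoeff α p i : ℂ) * expansionCoeff β r (l - i) := by
    rw [← mul_right_inj' hl, ← h, Finset.mul_sum]
    refine Finset.sum_congr rfl fun i hi => ?_
    rw [iteratedDeriv_complexExpansion, iteratedDeriv_complexExpansion,
      ← Nat.choose_mul_factorial_mul_factorial (Finset.mem_range_succ_iff.mp hi)]
    push_cast
    ring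
  exact_mod_cast key

lemma sum_mul_expansionCoeff_add_eq_zero {ι : Type*} [Fintype ι] {c a : ι → ℝ} {p : ι → ℤ} {q : ℕ}
    (h : ∀ l < q, ∑ i, c i * expansionCoeff (a i) (p i) l = 0) (β : ℝ) (r : ℤ) {l : ℕ}
    (hl : l < q) : ∑ i, c i * expansionCoeff (a i + β) (p i + r) l = 0 := by
  simp only [expansionCoeff_add, Finset.mul_sum, ← mul_assoc]
  rw [Finset.sum_comm]
  refine Finset.sum_eq_zero fun j hj => ?_
  rw [← Finset.sum_mul, h j (by grind), zero_mul]

lemma expansionCoeff_neg_determinant (α : ℝ) :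
    (6 * expansionCoeff (-α) (-1) 3 - expansionCoeff (-α) (-1) 1) *
        (12 * expansionCoeff (-α) 1 4 - expansionCoeff (-α) 1 2) -
      (12 * expansionCoeff (-α) (-1) 4 - expansionCoeff (-α) (-1) 2) *
        (6 * expansionCoeff (-α) 1 3 - expansionCoeff (-α) 1 1) =
      α ^ 2 * denom α / 1920 := by
  simp only [expansionCoeff_one, expansionCoeff_two, expansionCoeff_three, expansionCoeff_four,
    denom]
  push_cast
  ring

lemma homogeneous_dual {α g₁ g₂ m₁ m₀ m₂ : ℝ} {q : ℕ}
    (h : ∀ l < q, m₁ * expansionCoeff α 1 l + m₀ * expansionCoeff α 0 l +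
      m₂ * expansionCoeff α (-1) l = g₁ * ((-1) ^ l / l.factorial) + g₂ * (1 / l.factorial))
    {l : ℕ} (hl : l < q) :
    m₁ * (1 / l.factorial) + m₀ * (0 ^ l / l.factorial) + m₂ * ((-1) ^ l / l.factorial) =
      g₁ * expansionCoeff (-α) (-1) l + g₂ * expansionCoeff (-α) 1 l := by
  have hsum : ∀ l < q, ∑ i, ![m₁, m₀, m₂, -g₁, -g₂] i *
      expansionCoeff (![α, α, α, 0, 0] i) (![1, 0, -1, -1, 1] i) l = 0 := fun l hl => by
    simp only [Fin.sum_univ_five, Matrix.cons_val, expansionCoeff_zero_left, Int.cast_neg,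
      Int.cast_one]
    linear_combination h l hl
  have hdual := sum_mul_expansionCoeff_add_eq_zero hsum (-α) 0 hl
  simp only [Fin.sum_univ_five, Matrix.cons_val, add_neg_cancel, zero_add, add_zero,
    expansionCoeff_zero_left, Int.cast_neg, Int.cast_one, Int.cast_zero] at hdual
  linear_combination hdual

lemma eq_zero_of_homogeneous {α g₁ g₂ m₁ m₀ m₂ : ℝ} (hα : α ≠ 0) (hd : denom α ≠ 0)
    (h : ∀ l < 5, m₁ * expansionCoeff α 1 l + m₀ * expansionCoeff α 0 l +
      m₂ * expansionCoeff α (-1) l = g₁ * ((-1) ^ l / l.factorial) + g₂ * (1 / l.factorial)) :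
    g₁ = 0 ∧ g₂ = 0 ∧ m₁ = 0 ∧ m₀ = 0 ∧ m₂ = 0 := by
  have d₀ := homogeneous_dual h (l := 0) (by norm_num)
  have d₁ := homogeneous_dual h (l := 1) (by norm_num)
  have d₂ := homogeneous_dual h (l := 2) (by norm_num)
  have d₃ := homogeneous_dual h (l := 3) (by norm_num)
  have d₄ := homogeneous_dual h (l := 4) (by norm_num)
  norm_num [Nat.factorial, expansionCoeff_zero] at d₀ d₁ d₂ d₃ d₄
  have hdet : α ^ 2 * denom α / 1920 ≠ 0 := by positivity
  have hg₁ : g₁ = 0 := by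
    refine (mul_eq_zero.mp ?_).resolve_right hdet
    rw [← expansionCoeff_neg_determinant]
    linear_combination (12 * expansionCoeff (-α) 1 4 - expansionCoeff (-α) 1 2) * (d₁ - 6 * d₃) -
      (6 * expansionCoeff (-α) 1 3 - expansionCoeff (-α) 1 1) * (d₂ - 12 * d₄)
  have hg₂ : g₂ = 0 := by
    refine (mul_eq_zero.mp ?_).resolve_right hdet
    rw [← expansionCoeff_neg_determinant]
    linear_combination (6 * expansionCoeff (-α) (-1) 3 - expansionCoeff (-α) (-1) 1) *
        (d₂ - 12 * d₄) -
      (12 * expansionCoeff (-α) (-1) 4 - expansionCoeff (-α) (-1) 2) * (d₁ - 6 * d₃)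
  simp only [hg₁, hg₂] at d₀ d₁ d₂
  refine ⟨hg₁, hg₂, ?_, ?_, ?_⟩ <;> linarith

lemma coefficientSystem_iff_forall_lt {α g₁ g₂ m₁ m₀ m₂ : ℝ} :
    CoefficientSystem α g₁ g₂ m₁ m₀ m₂ ↔ ∀ l < 5,
      m₁ * expansionCoeff α 1 l + m₀ * expansionCoeff α 0 l + m₂ * expansionCoeff α (-1) l =
        g₁ * ((-1) ^ l / l.factorial) + 0 ^ l / l.factorial + g₂ * (1 / l.factorial) := by
  simp only [Nat.forall_lt_succ_right, CoefficientSystem]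
  norm_num [expansionCoeff_zero, Nat.factorial, and_assoc]
  constructor <;> rintro ⟨h₀, h₁, h₂, h₃, h₄⟩ <;> refine ⟨?_, ?_, ?_, ?_, ?_⟩ <;> linarith

lemma muZero_eq (α : ℝ) :
    muZero α = 2 * (862 + α - 285 * α ^ 2 + 15 * α ^ 3 + 15 * α ^ 4) / denom α := by
  have : denom α = 2 * (862 - α - 285 * α ^ 2 - 15 * α ^ 3 + 15 * α ^ 4) := by
    unfold denom; ring
  rw [muZero, this, mul_div_mul_left _ _ two_ne_zero]

lemma coefficientSystem_solution {α : ℝ} (hd : denom α ≠ 0) :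
    CoefficientSystem α (gammaOne α) (gammaTwo α) (muOne α) (muZero α) (muNegOne α) := by
  simp only [CoefficientSystem, expansionCoeff_one, expansionCoeff_two, expansionCoeff_three,
    expansionCoeff_four, muZero_eq, gammaOne, gammaTwo, muOne, muNegOne]
  push_cast
  refine ⟨?_, ?_, ?_, ?_, ?_⟩ <;> field_simp <;> unfold denom <;> ring

lemma coefficientSystem_iff {α : ℝ} (hα : α ≠ 0) (hd : denom α ≠ 0) (g₁ g₂ m₁ m₀ m₂ : ℝ) :
    CoefficientSystem α g₁ g₂ m₁ m₀ m₂ ↔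
      g₁ = gammaOne α ∧ g₂ = gammaTwo α ∧ m₁ = muOne α ∧ m₀ = muZero α ∧ m₂ = muNegOne α := by
  have hsol := coefficientSystem_solution hd
  refine ⟨fun h => ?_, by rintro ⟨rfl, rfl, rfl, rfl, rfl⟩; exact hsol⟩
  rw [coefficientSystem_iff_forall_lt] at h hsol
  simp only [← sub_eq_zero (b := gammaOne α), ← sub_eq_zero (b := gammaTwo α),
    ← sub_eq_zero (b := muOne α), ← sub_eq_zero (b := muZero α), ← sub_eq_zero (b := muNegOne α)]
  exact eq_zero_of_homogeneous hα hd fun l hl => by linear_combination h l hl - hsol l hl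

end CoefficientSystem

section SchemeSymbol

/-- A compact difference scheme for the left Riemann-Liouville derivative: the combination of its
values at the points `x + derivNode j * h` with weights `derivWeight j` is approximated by the
combination of the Grünwald-Letnikov operators with shifts `diffShift i` and weights
`diffWeight i`. -/
structure CompactScheme (ι κ : Type*) where
  derivWeight : ι → ℝ
  derivNode : ι → ℝ
  diffWeight : κ → ℝ
  diffShift : κ → ℤ

lemma isBigO_pow_of_iteratedDeriv_eq_zero {𝕜 : Type*} [NontriviallyNormedField 𝕜]
    [CompleteSpace 𝕜] [CharZero 𝕜] {f : 𝕜 → 𝕜} {x : 𝕜} {q : ℕ} (hf : AnalyticAt 𝕜 f x)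
    (h : ∀ l < q, iteratedDeriv l f x = 0) : f =O[𝓝 x] fun z => (z - x) ^ q := by
  obtain ⟨g, hg, hfg⟩ := (natCast_le_analyticOrderAt hf).mp
    ((natCast_le_analyticOrderAt_iff_iteratedDeriv_eq_zero hf).mpr h)
  have hbounded : g =O[𝓝 x] fun _ => (1 : 𝕜) := hg.continuousAt.norm.isBoundedUnder_le.isBigO_one 𝕜
  refine EventuallyEq.trans_isBigO hfg ?_
  simpa using (isBigO_refl (fun z => (z - x) ^ q) (𝓝 x)).mul hbounded

lemma one_sub_exp_neg_cpow {z : ℂ} (hz : z ≠ 0) (hre : 0 ≤ z.re) (hb : 0 < (expQuotient z).re)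
    (a : ℂ) : (1 - Complex.exp (-z)) ^ a = z ^ a * expQuotient z ^ a := by
  have hb0 : expQuotient z ≠ 0 := fun h => by simp [h] at hb
  have harg := abs_le.mp (Complex.abs_arg_le_pi_div_two_iff.mpr hre)
  have harg' := abs_lt.mp (Complex.abs_arg_lt_pi_div_two_iff.mpr (Or.inl hb))
  have hlog : Complex.log (z * expQuotient z) = Complex.log z + Complex.log (expQuotient z) :=
    (Complex.log_mul_eq_add_log_iff hz hb0).mpr ⟨by linarith, by linarith⟩
  rw [← mul_expQuotient, Complex.cpow_def_of_ne_zero (mul_ne_zero hz hb0), hlog, add_mul,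
    Complex.exp_add, Complex.cpow_def_of_ne_zero hz, Complex.cpow_def_of_ne_zero hb0]

namespace CompactScheme

variable {ι κ : Type*} [Fintype ι] [Fintype κ] (S : CompactScheme ι κ)

/-- The condition that the power series of
`∑ i, diffWeight i * ((1 - e^(-z)) / z)^α * e^(diffShift i * z)` and of
`∑ j, derivWeight j * e^(derivNode j * z)` agree up to terms of order `z^q`. -/
def MatchesMoments (α : ℝ) (q : ℕ) : Prop :=
  ∀ l < q, ∑ i, S.diffWeight i * expansionCoeff α (S.diffShift i) l =
    ∑ j, S.derivWeight j * (S.derivNode j ^ l / l.factorial)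

/-- The Fourier symbol of the error of the scheme of step size `1`: the factor by which the error
multiplies `e^(z x)`, where `z` is imaginary. -/
def symbol (α : ℝ) (z : ℂ) : ℂ :=
  z ^ (α : ℂ) * ∑ j, S.derivWeight j * Complex.exp (S.derivNode j * z) -
    (1 - Complex.exp (-z)) ^ (α : ℂ) * ∑ i, S.diffWeight i * Complex.exp (S.diffShift i * z)

/-- The quotient of `symbol` by `z ^ α`, which unlike `symbol` is analytic at `0`. -/
def reducedSymbol (α : ℝ) (z : ℂ) : ℂ :=
  ∑ j, S.derivWeight j * Complex.exp (S.derivNode j * z) -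
    ∑ i, S.diffWeight i * complexExpansion α (S.diffShift i) z

lemma analyticAt_reducedSymbol (α : ℝ) : AnalyticAt ℂ (S.reducedSymbol α) 0 :=
  .fun_sub (by fun_prop) <| Finset.analyticAt_fun_sum _ fun _ _ =>
    analyticAt_const.mul (analyticAt_complexExpansion _ _)

variable {S} {α : ℝ} {q : ℕ}

lemma MatchesMoments.iteratedDeriv_reducedSymbol (hS : S.MatchesMoments α q) {l : ℕ}
    (hl : l < q) : iteratedDeriv l (S.reducedSymbol α) 0 = 0 := by
  have hexp (c : ℂ) (r : ℝ) : ContDiffAt ℂ l (fun z => c * Complex.exp (r * z)) 0 := by fun_prop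
  have hF (c : ℂ) (p : ℤ) : ContDiffAt ℂ l (fun z => c * complexExpansion α p z) 0 :=
    contDiffAt_const.mul (analyticAt_complexExpansion α p).contDiffAt
  have hmoment := congrArg ((l.factorial : ℂ) * ((↑) : ℝ → ℂ) ·) (hS l hl)
  have hfac : (l.factorial : ℂ) ≠ 0 := Nat.cast_ne_zero.mpr l.factorial_ne_zero
  unfold reducedSymbol
  rw [iteratedDeriv_fun_sub (.sum fun _ _ => hexp _ _) (.sum fun _ _ => hF _ _),
    iteratedDeriv_fun_sum fun _ _ => hexp _ _, iteratedDeriv_fun_sum fun _ _ => hF _ _, sub_eq_zero]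
  simp only [iteratedDeriv_const_mul_field, iteratedDeriv_cexp_const_mul,
    iteratedDeriv_complexExpansion, mul_zero, Complex.exp_zero, mul_one]
  push_cast [Finset.mul_sum] at hmoment
  convert hmoment.symm using 2 with j _ i _
  · field_simp
  · ring

lemma symbol_eq_cpow_mul_reducedSymbol {z : ℂ} (hz : z ≠ 0) (hre : 0 ≤ z.re)
    (hb : 0 < (expQuotient z).re) :
    S.symbol α z = z ^ (α : ℂ) * S.reducedSymbol α z := by
  simp only [symbol, reducedSymbol, complexExpansion, one_sub_exp_neg_cpow hz hre hb, mul_sub,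
    Finset.mul_sum]
  congr! 2
  ring

lemma MatchesMoments.eventually_norm_symbol_le (hS : S.MatchesMoments α q) :
    ∃ C ≥ 0, ∀ᶠ z in 𝓝 (0 : ℂ), z ≠ 0 → 0 ≤ z.re → ‖S.symbol α z‖ ≤ C * ‖z‖ ^ (q + α) := by
  obtain ⟨C, hC, hbound⟩ := (isBigO_pow_of_iteratedDeriv_eq_zero (S.analyticAt_reducedSymbol α)
    fun _ => hS.iteratedDeriv_reducedSymbol).exists_nonneg
  have hre : ∀ᶠ z in 𝓝 (0 : ℂ), 0 < (expQuotient z).re :=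
    (Complex.continuous_re.continuousAt.comp (analyticAt_expQuotient 0).continuousAt).eventually_mem
      (isOpen_Ioi.mem_nhds (by simp [expQuotient_zero]))
  refine ⟨C, hC, ?_⟩
  filter_upwards [hbound.bound, hre] with z hred hb hz hzre
  rw [sub_zero, norm_pow] at hred
  calc ‖S.symbol α z‖ = ‖z‖ ^ α * ‖S.reducedSymbol α z‖ := by
        rw [symbol_eq_cpow_mul_reducedSymbol hz hzre hb, norm_mul, Complex.norm_cpow_real]
    _ ≤ ‖z‖ ^ α * (C * ‖z‖ ^ q) := by gcongr
    _ = C * ‖z‖ ^ (q + α) := by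
        rw [Real.rpow_add (norm_pos_iff.mpr hz), Real.rpow_natCast]
        ring

lemma norm_symbol_le (hα : 0 ≤ α) {z : ℂ} (hz : z.re = 0) :
    ‖S.symbol α z‖ ≤ ‖z‖ ^ α * ∑ j, |S.derivWeight j| + 2 ^ α * ∑ i, |S.diffWeight i| := by
  have hexp (c r : ℝ) : ‖(c : ℂ) * Complex.exp (r * z)‖ = |c| := by
    simp [Complex.norm_exp, hz]
  have hbase : ‖1 - Complex.exp (-z)‖ ≤ 2 := by
    refine (norm_sub_le _ _).trans ?_
    norm_num [Complex.norm_exp, hz]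
  refine (norm_sub_le _ _).trans ?_
  rw [norm_mul, norm_mul, Complex.norm_cpow_real, Complex.norm_cpow_real]
  gcongr
  · exact (norm_sum_le _ _).trans_eq (Finset.sum_congr rfl fun j _ => hexp _ _)
  · exact (norm_sum_le _ _).trans_eq (Finset.sum_congr rfl fun i _ => by
      simpa using hexp (S.diffWeight i) (S.diffShift i))

/-- Near `0` this is the moment condition; away from `0` the symbol is `O(|z|^α)` anyway. -/
lemma MatchesMoments.exists_norm_symbol_le (hα : 0 < α) (hS : S.MatchesMoments α q) :
    ∃ C, ∀ z : ℂ, z.re = 0 → ‖S.symbol α z‖ ≤ C * ‖z‖ ^ (q + α) := by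
  obtain ⟨C, hC, hev⟩ := hS.eventually_norm_symbol_le
  obtain ⟨r, hr, hnear⟩ := Metric.eventually_nhds_iff.mp hev
  set A := ∑ j, |S.derivWeight j|
  set B := 2 ^ α * ∑ i, |S.diffWeight i|
  refine ⟨C + (A / r ^ (q : ℝ) + B / r ^ (q + α)), fun z hre => ?_⟩
  rcases eq_or_ne z 0 with rfl | hz
  · simp [symbol, hα.ne', (by positivity : (q + α) ≠ 0)]
  have hzp : 0 < ‖z‖ := norm_pos_iff.mpr hz
  rw [add_mul]
  rcases lt_or_ge ‖z‖ r with hzr | hzr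
  · refine (hnear (by simpa using hzr) hz hre.ge).trans (le_add_of_nonneg_right ?_)
    positivity
  · have hone {e : ℝ} (he : 0 ≤ e) : 1 ≤ ‖z‖ ^ e / r ^ e :=
      (one_le_div (by positivity)).mpr (Real.rpow_le_rpow hr.le hzr he)
    calc ‖S.symbol α z‖ ≤ ‖z‖ ^ α * A + B := norm_symbol_le hα.le hre
      _ ≤ ‖z‖ ^ α * A * (‖z‖ ^ (q : ℝ) / r ^ (q : ℝ)) + B * (‖z‖ ^ (q + α) / r ^ (q + α)) :=
          add_le_add (le_mul_of_one_le_right (by positivity) (hone (by positivity)))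
            (le_mul_of_one_le_right (by positivity) (hone (by positivity)))
      _ = (A / r ^ (q : ℝ) + B / r ^ (q + α)) * ‖z‖ ^ (q + α) := by
          rw [Real.rpow_add hzp]
          ring
      _ ≤ _ := le_add_of_nonneg_left (by positivity)

end CompactScheme

end SchemeSymbol

section GrunwaldWeights

variable {α : ℝ}

lemma grunwaldWeight_zero (hα : ∀ k : ℕ, α ≠ k) : grunwaldWeight α 0 = 1 := by
  have hΓ : Real.Gamma (-α) ≠ 0 := Real.Gamma_ne_zero fun m h => hα m (neg_injective h)
  simp [grunwaldWeight, hΓ]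

lemma grunwaldWeight_succ {k : ℕ} (hk : α ≠ k) :
    grunwaldWeight α (k + 1) = grunwaldWeight α k * ((k - α) / (k + 1)) := by
  have hk1 : (k : ℝ) + 1 ≠ 0 := k.cast_add_one_ne_zero
  simp only [grunwaldWeight]
  push_cast
  rw [add_sub_right_comm, Real.Gamma_add_one (sub_ne_zero.mpr hk.symm), Real.Gamma_add_one hk1]
  field_simp

/- Telescoping: for `k ≥ α` the quantities `|g_k| (k - α) / α` decrease with increments
`|g_(k + 1)|`. -/
lemma summable_grunwaldWeight (hα₀ : 0 < α) (hα : ∀ k : ℕ, α ≠ k) :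
    Summable (grunwaldWeight α) := by
  obtain ⟨K, hK⟩ := exists_nat_ge α
  set T : ℕ → ℝ := fun k => |grunwaldWeight α (k + K)| * ((k + K : ℕ) - α) / α with hT
  have hKα (k : ℕ) : 0 ≤ ((k + K : ℕ) : ℝ) - α := by
    push_cast
    linarith [k.cast_nonneg (α := ℝ)]
  have hstep (k : ℕ) : |grunwaldWeight α (k + (K + 1))| = T k - T (k + 1) := by
    have hk1 : ((k + K : ℕ) : ℝ) + 1 ≠ 0 := Nat.cast_add_one_ne_zero _
    have habs : |grunwaldWeight α (k + K + 1)| =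
        |grunwaldWeight α (k + K)| * ((((k + K : ℕ) : ℝ) - α) / ((k + K : ℕ) + 1)) := by
      rw [grunwaldWeight_succ (hα _), abs_mul,
        abs_of_nonneg (div_nonneg (hKα k) (Nat.cast_add_one_pos _).le)]
    simp only [hT, ← add_assoc, add_right_comm k 1 K, habs, Nat.cast_add_one]
    field_simp
    ring
  rw [← summable_nat_add_iff (K + 1), ← summable_abs_iff]
  refine summable_of_sum_range_le (c := T 0) (fun _ => abs_nonneg _) fun n => ?_
  rw [Finset.sum_congr rfl fun k _ => hstep k, Finset.sum_range_sub']
  exact sub_le_self _ (div_nonneg (mul_nonneg (abs_nonneg _) (hKα n)) hα₀.le)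

lemma grunwaldWeight_eq_neg_one_pow_mul_choose (hα : ∀ k : ℕ, α ≠ k) (k : ℕ) :
    (grunwaldWeight α k : ℂ) = (-1) ^ k * Ring.choose (α : ℂ) k := by
  induction k with
  | zero => simp [grunwaldWeight_zero hα]
  | succ k ih =>
    have hk : (k : ℂ) + 1 ≠ 0 := k.cast_add_one_ne_zero
    have hf : (k.factorial : ℂ) ≠ 0 := Nat.cast_ne_zero.mpr k.factorial_ne_zero
    rw [grunwaldWeight_succ (hα k)]
    push_cast
    rw [ih]
    simp only [Ring.choose_eq_smul, descPochhammer_succ_right, Polynomial.smeval_mul,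
      Polynomial.smeval_sub, Polynomial.smeval_X, Polynomial.smeval_natCast, Nat.factorial_succ,
      smul_eq_mul, nsmul_eq_mul, pow_zero, pow_one, mul_one]
    push_cast
    field_simp
    ring

lemma hasSum_grunwaldWeight_mul_pow_of_norm_lt_one (hα : ∀ k : ℕ, α ≠ k) {w : ℂ} (hw : ‖w‖ < 1) :
    HasSum (fun k : ℕ => (grunwaldWeight α k : ℂ) * w ^ k) ((1 - w) ^ (α : ℂ)) := by
  have h := (Complex.one_add_cpow_hasFPowerSeriesOnBall_zero (a := (α : ℂ))).hasSum
    (y := -w) (by rwa [← ENNReal.ofReal_one, Metric.eball_ofReal, mem_ball_zero_iff, norm_neg])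
  rw [zero_add, ← sub_eq_add_neg] at h
  refine h.congr_fun fun k => ?_
  rw [binomialSeries_apply, grunwaldWeight_eq_neg_one_pow_mul_choose hα]
  simp [neg_pow w, mul_left_comm, mul_assoc]

lemma summable_grunwaldWeight_mul_of_norm_le {b : ℕ → ℂ} {B : ℝ} (hα₀ : 0 < α)
    (hα : ∀ k : ℕ, α ≠ k) (hb : ∀ k, ‖b k‖ ≤ B) :
    Summable fun k => (grunwaldWeight α k : ℂ) * b k := by
  refine .of_norm_bounded ((summable_grunwaldWeight hα₀ hα).abs.mul_right B) fun k => ?_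
  rw [norm_mul, Complex.norm_real, Real.norm_eq_abs]
  gcongr
  exact hb k

/-- Abel's theorem carries the binomial series to the boundary of the disc. -/
lemma tsum_grunwaldWeight_mul_pow (hα₀ : 0 < α) (hα : ∀ k : ℕ, α ≠ k) {w : ℂ} (hw : ‖w‖ ≤ 1) :
    ∑' k : ℕ, (grunwaldWeight α k : ℂ) * w ^ k = (1 - w) ^ (α : ℂ) := by
  have hsum : Summable fun k : ℕ => (grunwaldWeight α k : ℂ) * w ^ k :=
    summable_grunwaldWeight_mul_of_norm_le hα₀ hα (B := 1) fun k => by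
      simpa using pow_le_one₀ (norm_nonneg w) hw
  have habel := Complex.tendsto_tsum_powerSeries_nhdsWithin_lt hsum.hasSum.tendsto_sum_nat
  rw [tendsto_map'_iff] at habel
  have hinside : ∀ᶠ r : ℝ in 𝓝[<] 1, (1 - w * r) ^ (α : ℂ) =
      ∑' k : ℕ, (grunwaldWeight α k : ℂ) * w ^ k * (r : ℂ) ^ k := by
    filter_upwards [Ioo_mem_nhdsLT zero_lt_one] with r hr
    have hwr : ‖w * r‖ < 1 := by
      rw [norm_mul, Complex.norm_real, Real.norm_of_nonneg hr.1.le]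
      exact (mul_le_of_le_one_left hr.1.le hw).trans_lt hr.2
    simpa only [mul_pow, ← mul_assoc] using
      (hasSum_grunwaldWeight_mul_pow_of_norm_lt_one hα hwr).tsum_eq.symm
  have hlim : Tendsto (fun r : ℝ => (1 - w * r) ^ (α : ℂ)) (𝓝[<] 1) (𝓝 ((1 - w) ^ (α : ℂ))) := by
    have hpow : ContinuousAt (fun x : ℂ => x ^ (α : ℂ)) (1 - w * (1 : ℝ)) :=
      Complex.continuousAt_cpow_const_of_re_pos
        (Or.inl (by simpa using (Complex.re_le_norm w).trans hw)) (by simpa using hα₀)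
    have hcomp : ContinuousAt (fun r : ℝ => (1 - w * r) ^ (α : ℂ)) 1 :=
      hpow.comp (f := fun r : ℝ => 1 - w * (r : ℂ)) (by fun_prop)
    simpa using hcomp.tendsto.mono_left nhdsWithin_le_nhds
  exact tendsto_nhds_unique habel (hlim.congr' hinside)

end GrunwaldWeights

section Laplace

variable {a : ℝ}

lemma integrableOn_rpow_mul_exp_neg_mul (ha : 0 < a) {r : ℝ} (hr : 0 < r) :
    IntegrableOn (fun t : ℝ => t ^ (a - 1) * Real.exp (-(r * t))) (Ioi 0) := by
  simpa using integrableOn_rpow_mul_exp_neg_mul_rpow (p := 1) (s := a - 1) (b := r)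
    (by linarith) zero_lt_one hr

/- The integral is the complex moment generating function of `-t` for the measure
`t ^ (a - 1) dt`, which is known to be analytic. -/
lemma analyticOnNhd_integral_rpow_mul_cexp_neg_mul (ha : 0 < a) :
    AnalyticOnNhd ℂ (fun r : ℂ => ∫ t in Ioi (0 : ℝ), ((t ^ (a - 1) : ℝ) : ℂ) *
      Complex.exp (-(r * t))) {r | 0 < r.re} := by
  set μ : Measure ℝ :=
    (volume.restrict (Ioi 0)).withDensity fun t => ((t ^ (a - 1)).toNNReal : ENNReal) with hμ
  have hmeas : Measurable fun t : ℝ => (t ^ (a - 1)).toNNReal := by fun_prop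
  have hdensity {t : ℝ} (ht : t ∈ Ioi (0 : ℝ)) : ((t ^ (a - 1)).toNNReal : ℝ) = t ^ (a - 1) :=
    Real.coe_toNNReal _ (Real.rpow_nonneg (le_of_lt ht) _)
  have hmgf : ProbabilityTheory.complexMGF (fun t => -t) μ = fun r : ℂ =>
      ∫ t in Ioi (0 : ℝ), ((t ^ (a - 1) : ℝ) : ℂ) * Complex.exp (-(r * t)) := by
    ext r
    rw [ProbabilityTheory.complexMGF, hμ, integral_withDensity_eq_integral_smul hmeas]
    refine setIntegral_congr_fun measurableSet_Ioi fun t ht => ?_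
    simp [NNReal.smul_def, -Real.coe_toNNReal', hdensity ht]
  have hset : Ioi 0 ⊆ ProbabilityTheory.integrableExpSet (fun t => -t) μ := fun r hr => by
    rw [ProbabilityTheory.integrableExpSet, Set.mem_ofPred_eq, hμ,
      integrable_withDensity_iff_integrable_smul hmeas]
    refine (integrableOn_rpow_mul_exp_neg_mul ha hr).congr_fun (fun t ht => ?_) measurableSet_Ioi
    simp [NNReal.smul_def, -Real.coe_toNNReal', hdensity ht]
  rw [← hmgf]
  exact ProbabilityTheory.analyticOnNhd_complexMGF.mono fun r hr =>
    interior_maximal hset isOpen_Ioi hr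

lemma integral_rpow_mul_cexp_neg_ofReal_mul (ha : 0 < a) {r : ℝ} (hr : 0 < r) :
    ∫ t in Ioi (0 : ℝ), ((t ^ (a - 1) : ℝ) : ℂ) * Complex.exp (-(r * t)) =
      Real.Gamma a * (r : ℂ) ^ (-a : ℂ) := by
  calc _ = ((∫ t in Ioi (0 : ℝ), t ^ (a - 1) * Real.exp (-(r * t)) : ℝ) : ℂ) := by
        rw [← integral_complex_ofReal]
        push_cast
        rfl
    _ = _ := by
        rw [Real.integral_rpow_mul_exp_neg_mul_Ioi ha hr, one_div, Real.inv_rpow hr.le,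
          ← Real.rpow_neg hr.le]
        push_cast [Complex.ofReal_cpow hr.le]
        ring

lemma integral_rpow_mul_cexp_neg_mul (ha : 0 < a) {r : ℂ} (hr : 0 < r.re) :
    ∫ t in Ioi (0 : ℝ), ((t ^ (a - 1) : ℝ) : ℂ) * Complex.exp (-(r * t)) =
      Real.Gamma a * r ^ (-a : ℂ) := by
  have hG : AnalyticOnNhd ℂ (fun r : ℂ => Real.Gamma a * r ^ (-a : ℂ)) {r | 0 < r.re} :=
    fun r hr => analyticAt_const.mul (analyticAt_id.cpow analyticAt_const (Or.inl hr))
  refine (analyticOnNhd_integral_rpow_mul_cexp_neg_mul ha).eqOn_of_preconnected_of_frequently_eq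
    hG (convex_halfSpace_re_gt 0).isPreconnected (z₀ := 1) (by simp) ?_ hr
  have hmap : Tendsto ((↑) : ℝ → ℂ) (𝓝[≠] 1) (𝓝[≠] 1) := by
    refine tendsto_nhdsWithin_iff.mpr
      ⟨by simpa using (Complex.continuous_ofReal.tendsto 1).mono_left nhdsWithin_le_nhds, ?_⟩
    filter_upwards [self_mem_nhdsWithin] with x hx
    simpa using hx
  refine hmap.frequently (Eventually.frequently ?_)
  filter_upwards [nhdsWithin_le_nhds (Ioi_mem_nhds zero_lt_one)] with x hx
  exact integral_rpow_mul_cexp_neg_ofReal_mul ha hx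

end Laplace

section SpectralDensity

/-- The imaginary frequency `2πiw`, at which the symbols of the difference operators are
evaluated. -/
def freq (w : ℝ) : ℂ := 2 * Real.pi * Complex.I * w

lemma freq_re (w : ℝ) : (freq w).re = 0 := by simp [freq]

lemma norm_freq (w : ℝ) : ‖freq w‖ = 2 * Real.pi * |w| := by
  simp [freq, abs_of_pos Real.pi_pos]

lemma freq_ne_zero {w : ℝ} (hw : w ≠ 0) : freq w ≠ 0 := by
  simp [freq, hw, Real.pi_ne_zero]

lemma freq_mem_slitPlane {w : ℝ} (hw : w ≠ 0) : freq w ∈ Complex.slitPlane :=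
  Or.inr (by simp [freq, hw, Real.pi_ne_zero])

@[fun_prop]
lemma measurable_freq : Measurable freq := by unfold freq; fun_prop

lemma norm_exp_freq_mul (w t : ℝ) : ‖Complex.exp (freq w * t)‖ = 1 := by
  simp [Complex.norm_exp, freq_re]

lemma norm_freq_cpow (w a : ℝ) :
    ‖freq w ^ (a : ℂ)‖ = (2 * Real.pi) ^ a * |w| ^ a := by
  rw [Complex.norm_cpow_real, norm_freq, Real.mul_rpow (by positivity) (abs_nonneg w)]

lemma fourierInv_eq_integral_freq (V : ℝ → ℂ) (x : ℝ) :
    FourierTransformInv.fourierInv V x = ∫ w, V w * Complex.exp (freq w * x) := by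
  rw [Real.fourierInv_eq']
  refine integral_congr_ae (Eventually.of_forall fun w => ?_)
  simp only [smul_eq_mul, freq, mul_comm (V w)]
  congr 2
  simp
  ring

lemma integrable_abs_rpow_mul_inv_one_add_abs_pow {s : ℝ} {N : ℕ} (hs : -1 < s)
    (hsN : s < N - 1) : Integrable fun w : ℝ => |w| ^ s * (1 + |w| ^ N)⁻¹ := by
  have hcont : ContinuousOn (fun t : ℝ => (1 + t ^ N)⁻¹) (Ici 0) :=
    (by fun_prop : Continuous fun t : ℝ => 1 + t ^ N).continuousOn.inv₀ fun t (ht : 0 ≤ t) => by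
      positivity
  have htop : (fun t : ℝ => (1 + t ^ N)⁻¹) =O[atTop] fun t : ℝ => t ^ (-(N : ℝ)) := by
    refine IsBigO.of_bound' ?_
    filter_upwards [eventually_gt_atTop 0] with t ht
    rw [Real.rpow_neg ht.le, Real.rpow_natCast, Real.norm_of_nonneg (by positivity),
      Real.norm_of_nonneg (by positivity)]
    gcongr
    linarith
  have hzero : (fun t : ℝ => (1 + t ^ N)⁻¹) =O[𝓝[>] 0] fun t : ℝ => t ^ (-(0 : ℝ)) := by
    refine IsBigO.of_bound' ?_
    filter_upwards [self_mem_nhdsWithin] with t (ht : 0 < t)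
    rw [neg_zero, Real.rpow_zero, norm_one, Real.norm_of_nonneg (by positivity)]
    exact inv_le_one_of_one_le₀ (le_add_of_nonneg_right (by positivity))
  have hmellin := mellin_convergent_of_isBigO_scalar (s := s + 1)
    ((hcont.mono Ioi_subset_Ici_self).locallyIntegrableOn measurableSet_Ioi) htop
    (by linarith) hzero (by linarith)
  refine (integrable_fun_norm_addHaar volume (f := fun t : ℝ => t ^ s * (1 + t ^ N)⁻¹)).mpr ?_
  simpa using hmellin

/-- `HasSpectralDensity u V M` says that `u` is the inverse Fourier transform of the measurable
function `V`, whose absolute moments of all orders in `(-1, M]` are finite. Working with moments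
instead of smoothness of `u` puts fractional derivatives and difference operators on the same
footing: they multiply `V` by functions of the frequency. -/
structure HasSpectralDensity (u : ℝ → ℝ) (V : ℝ → ℂ) (M : ℝ) : Prop where
  measurable : Measurable V
  order_nonneg : 0 ≤ M
  integrable_abs_rpow_mul_norm : ∀ ⦃s : ℝ⦄, -1 < s → s ≤ M →
    Integrable fun w => |w| ^ s * ‖V w‖
  eq_integral : ∀ x, (u x : ℂ) = ∫ w, V w * Complex.exp (freq w * x)

namespace HasSpectralDensity

variable {u : ℝ → ℝ} {V : ℝ → ℂ} {M : ℝ}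

lemma integrable (hV : HasSpectralDensity u V M) : Integrable V := by
  have hmoment := hV.integrable_abs_rpow_mul_norm neg_one_lt_zero hV.order_nonneg
  simp only [Real.rpow_zero, one_mul] at hmoment
  exact (integrable_norm_iff hV.measurable.aestronglyMeasurable).mp hmoment

lemma abs_le (hV : HasSpectralDensity u V M) (x : ℝ) : |u x| ≤ ∫ w, ‖V w‖ := by
  rw [← Real.norm_eq_abs, ← Complex.norm_real, hV.eq_integral]
  refine (norm_integral_le_integral_norm _).trans_eq ?_
  simp [norm_exp_freq_mul]

lemma integrable_mul_of_norm_le (hV : HasSpectralDensity u V M) {s C : ℝ} (hs : -1 < s)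
    (hsM : s ≤ M) {m : ℝ → ℂ} (hm : Measurable m) (hb : ∀ w, ‖m w‖ ≤ C * |w| ^ s) :
    Integrable fun w => V w * m w := by
  refine Integrable.mono' ((hV.integrable_abs_rpow_mul_norm hs hsM).const_mul C)
    (hV.measurable.mul hm).aestronglyMeasurable (Eventually.of_forall fun w => ?_)
  calc ‖V w * m w‖ = ‖V w‖ * ‖m w‖ := norm_mul _ _
    _ ≤ ‖V w‖ * (C * |w| ^ s) := by gcongr; exact hb w
    _ = C * (|w| ^ s * ‖V w‖) := by ring

end HasSpectralDensity

lemma iteratedDeriv_ofReal_comp {f : ℝ → ℝ} {n : ℕ} (hf : ContDiff ℝ n f) :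
    iteratedDeriv n (fun x => (f x : ℂ)) = fun x => ((iteratedDeriv n f x : ℝ) : ℂ) := by
  ext x
  rw [iteratedDeriv_eq_iteratedFDeriv, iteratedDeriv_eq_iteratedFDeriv]
  exact DFunLike.congr_fun
    (Complex.ofRealCLM.iteratedFDeriv_comp_left hf.contDiffAt le_rfl) fun _ => 1

lemma norm_fourier_le_integral_norm (f : ℝ → ℂ) (w : ℝ) :
    ‖FourierTransform.fourier f w‖ ≤ ∫ x, ‖f x‖ :=
  VectorFourier.norm_fourierIntegral_le_integral_norm _ _ _ _ _

lemma continuous_fourier_of_integrable {f : ℝ → ℂ} (hf : Integrable f) :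
    Continuous (FourierTransform.fourier f) :=
  VectorFourier.fourierIntegral_continuous Real.continuous_fourierChar
    (by exact continuous_inner) hf

lemma abs_pow_mul_norm_fourier_le {f : ℝ → ℂ} {N : ℕ} (hf : ContDiff ℝ N f)
    (hint : ∀ k ≤ N, Integrable (iteratedDeriv k f)) (w : ℝ) :
    |w| ^ N * ‖FourierTransform.fourier f w‖ ≤ ∫ x, ‖iteratedDeriv N f x‖ := by
  refine le_trans ?_ (norm_fourier_le_integral_norm (iteratedDeriv N f) w)
  rw [Real.fourier_iteratedDeriv (N := N) (n := N) (by exact_mod_cast hf)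
    (fun k hk => hint k (by exact_mod_cast hk)) le_rfl, norm_smul, norm_pow]
  have hw : |w| ≤ ‖(2 * Real.pi * Complex.I * w : ℂ)‖ := by
    rw [show (2 * Real.pi * Complex.I * w : ℂ) = freq w from rfl, norm_freq]
    exact le_mul_of_one_le_left (abs_nonneg w) (by linarith [Real.pi_gt_three])
  gcongr

lemma exists_hasSpectralDensity {u : ℝ → ℝ} {N : ℕ} {M : ℝ} (hM : 0 ≤ M) (hMN : M < N - 1)
    (hu : ContDiff ℝ N u) (hint : ∀ k ≤ N, Integrable (iteratedDeriv k u)) :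
    ∃ V, HasSpectralDensity u V M := by
  set v : ℝ → ℂ := fun x => (u x : ℂ)
  have hv : ContDiff ℝ N v := Complex.ofRealCLM.contDiff.comp hu
  have hv_int (k : ℕ) (hk : k ≤ N) : Integrable (iteratedDeriv k v) := by
    rw [iteratedDeriv_ofReal_comp (hu.of_le (by exact_mod_cast hk))]
    exact (hint k hk).ofReal
  have hv₀ : Integrable v := by simpa using hv_int 0 N.zero_le
  set V : ℝ → ℂ := FourierTransform.fourier v
  have hV_cont : Continuous V := continuous_fourier_of_integrable hv₀
  obtain ⟨A, hA⟩ : ∃ A, ∀ w, ‖V w‖ ≤ A * (1 + |w| ^ N)⁻¹ := by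
    refine ⟨(∫ x, ‖v x‖) + ∫ x, ‖iteratedDeriv N v x‖, fun w => ?_⟩
    rw [← div_eq_mul_inv, le_div_iff₀ (by positivity)]
    linarith [norm_fourier_le_integral_norm v w, abs_pow_mul_norm_fourier_le hv hv_int w]
  have hmoment ⦃s : ℝ⦄ (hs : -1 < s) (hsM : s ≤ M) : Integrable fun w => |w| ^ s * ‖V w‖ := by
    refine ((integrable_abs_rpow_mul_inv_one_add_abs_pow hs
      (hsM.trans_lt hMN)).const_mul A).mono' ?_ (Eventually.of_forall fun w => ?_)
    · have := hV_cont.measurable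
      exact Measurable.aestronglyMeasurable (by fun_prop)
    · rw [Real.norm_of_nonneg (by positivity), mul_left_comm]
      gcongr
      exact hA w
  have hV_int : Integrable V := by
    rw [← integrable_norm_iff hV_cont.aestronglyMeasurable]
    simpa using hmoment neg_one_lt_zero hM
  refine ⟨V, hV_cont.measurable, hM, hmoment, fun x => ?_⟩
  rw [← fourierInv_eq_integral_freq, hv.continuous.fourierInv_fourier_eq hv₀ hV_int]

end SpectralDensity

section FractionalIntegral

lemma integrableOn_rpow_mul_comp_sub {u : ℝ → ℝ} {B : ℝ} (hb : ∀ t, |u t| ≤ B)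
    (hi : Integrable u) {a : ℝ} (ha₀ : 0 < a) (ha₁ : a ≤ 1) (x : ℝ) :
    IntegrableOn (fun t : ℝ => t ^ (a - 1) * u (x - t)) (Ioi 0) := by
  have hi_sub : Integrable fun t => u (x - t) := hi.comp_sub_left x
  rw [← Ioc_union_Ioi_eq_Ioi zero_le_one]
  refine IntegrableOn.union ?_ ?_
  · have hpow : IntegrableOn (fun t : ℝ => t ^ (a - 1)) (Ioc 0 1) := by
      rw [← intervalIntegrable_iff_integrableOn_Ioc_of_le zero_le_one]
      exact intervalIntegral.intervalIntegrable_rpow' (by linarith)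
    exact hpow.mul_bdd hi_sub.aestronglyMeasurable.restrict (Eventually.of_forall fun t => hb _)
  · refine hi_sub.integrableOn.bdd_mul (c := 1)
      (Measurable.aestronglyMeasurable (by fun_prop)) ?_
    filter_upwards [ae_restrict_mem measurableSet_Ioi] with t (ht : 1 < t)
    rw [Real.norm_of_nonneg (Real.rpow_nonneg (by linarith) _)]
    exact Real.rpow_le_one_of_one_le_of_nonpos ht.le (by linarith)

lemma tendsto_integral_cexp_neg_mul_mul {f : ℝ → ℂ} (hf : IntegrableOn f (Ioi 0)) :
    Tendsto (fun ε : ℝ => ∫ t in Ioi (0 : ℝ), Complex.exp (-(ε * t)) * f t) (𝓝[>] 0)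
      (𝓝 (∫ t in Ioi (0 : ℝ), f t)) := by
  refine tendsto_integral_filter_of_dominated_convergence (fun t => ‖f t‖)
    (Eventually.of_forall fun ε => ?_) ?_ hf.norm (Eventually.of_forall fun t => ?_)
  · exact (Measurable.aestronglyMeasurable (by fun_prop)).mul hf.aestronglyMeasurable
  · filter_upwards [self_mem_nhdsWithin] with ε (hε : 0 < ε)
    filter_upwards [ae_restrict_mem measurableSet_Ioi] with t (ht : 0 < t)
    rw [norm_mul, Complex.norm_exp]
    refine mul_le_of_le_one_left (norm_nonneg _) (Real.exp_le_one_iff.mpr ?_)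
    simpa using (mul_pos hε ht).le
  · have hcont : Continuous fun ε : ℝ => Complex.exp (-(ε * t)) * f t := by fun_prop
    simpa using (hcont.tendsto 0).mono_left nhdsWithin_le_nhds

lemma norm_add_freq_cpow_neg_le {a : ℝ} (ha : 0 ≤ a) (ε : ℝ) {w : ℝ}
    (hw : w ≠ 0) : ‖((ε : ℂ) + freq w) ^ (-a : ℂ)‖ ≤ (2 * Real.pi) ^ (-a) * |w| ^ (-a) := by
  have hle : ‖freq w‖ ≤ ‖ε + freq w‖ := by
    have him : ‖freq w‖ = |(ε + freq w).im| := by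
      simp [freq, abs_of_pos Real.pi_pos, abs_mul]
    exact him.trans_le (Complex.abs_im_le_norm _)
  rw [← norm_freq_cpow, ← Complex.ofReal_neg, Complex.norm_cpow_real, Complex.norm_cpow_real]
  exact Real.rpow_le_rpow_of_nonpos (norm_pos_iff.mpr (freq_ne_zero hw)) hle (by linarith)

namespace HasSpectralDensity

variable {u : ℝ → ℝ} {V : ℝ → ℂ} {M : ℝ}

lemma integral_cexp_neg_mul_rpow_mul_comp_sub (hV : HasSpectralDensity u V M) {a ε : ℝ}
    (ha : 0 < a) (hε : 0 < ε) (x : ℝ) :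
    ∫ t in Ioi (0 : ℝ), Complex.exp (-(ε * t)) * ((t ^ (a - 1) * u (x - t) : ℝ) : ℂ) =
      ∫ w, V w * Complex.exp (freq w * x) * (Real.Gamma a * (ε + freq w) ^ (-a : ℂ)) := by
  set k : ℝ → ℂ := fun t => ((t ^ (a - 1) * Real.exp (-(ε * t)) : ℝ) : ℂ) with hk
  have hk_int : IntegrableOn k (Ioi 0) := (integrableOn_rpow_mul_exp_neg_mul ha hε).ofReal
  have hprod : Integrable (Function.uncurry fun t w : ℝ =>
      Complex.exp (freq w * (x - t : ℝ)) * (k t * V w))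
      ((volume.restrict (Ioi 0)).prod volume) :=
    (hk_int.mul_prod hV.integrable).bdd_mul (c := 1)
      (Measurable.aestronglyMeasurable (by fun_prop))
      (Eventually.of_forall fun _ => (norm_exp_freq_mul _ _).le)
  calc _ = ∫ t in Ioi (0 : ℝ), ∫ w, Complex.exp (freq w * (x - t : ℝ)) * (k t * V w) := by
        refine integral_congr_ae (Eventually.of_forall fun t => ?_)
        simp only [hk, Complex.ofReal_mul, hV.eq_integral, ← integral_const_mul]
        refine integral_congr_ae (Eventually.of_forall fun w => ?_)
        push_cast
        ring
    _ = ∫ w, ∫ t in Ioi (0 : ℝ), Complex.exp (freq w * (x - t : ℝ)) * (k t * V w) :=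
        integral_integral_swap hprod
    _ = _ := by
        refine integral_congr_ae (Eventually.of_forall fun w => ?_)
        simp only
        rw [← integral_rpow_mul_cexp_neg_mul ha (r := ε + freq w) (by simpa [freq_re] using hε),
          ← integral_const_mul]
        refine integral_congr_ae (Eventually.of_forall fun t => ?_)
        simp only [hk]
        push_cast
        rw [show freq w * (x - t : ℂ) = freq w * x + -(freq w * t) by ring, Complex.exp_add,
          show -(((ε : ℂ) + freq w) * t) = -(ε * t) + -(freq w * t) by ring, Complex.exp_add]
        ring

lemma tendsto_integral_add_freq_cpow_neg (hV : HasSpectralDensity u V M) {a : ℝ} (ha₀ : 0 ≤ a)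
    (ha₁ : a < 1) (c : ℂ) (x : ℝ) :
    Tendsto (fun ε : ℝ => ∫ w, V w * Complex.exp (freq w * x) * (c * (ε + freq w) ^ (-a : ℂ)))
      (𝓝[>] 0) (𝓝 (∫ w, V w * Complex.exp (freq w * x) * (c * freq w ^ (-a : ℂ)))) := by
  have hV_meas := hV.measurable
  have hae : ∀ᵐ w : ℝ, w ≠ 0 := by simp [ae_iff]
  refine tendsto_integral_filter_of_dominated_convergence
    (fun w => ‖c‖ * (2 * Real.pi) ^ (-a) * (|w| ^ (-a) * ‖V w‖))
    (Eventually.of_forall fun ε => Measurable.aestronglyMeasurable (by fun_prop))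
    (Eventually.of_forall fun ε => ?_)
    ((hV.integrable_abs_rpow_mul_norm (by linarith) (by linarith [hV.order_nonneg])).const_mul _)
    ?_
  · filter_upwards [hae] with w hw
    simp only [norm_mul, norm_exp_freq_mul, mul_one]
    calc ‖V w‖ * (‖c‖ * ‖((ε : ℂ) + freq w) ^ (-a : ℂ)‖)
        ≤ ‖V w‖ * (‖c‖ * ((2 * Real.pi) ^ (-a) * |w| ^ (-a))) := by
          gcongr
          exact norm_add_freq_cpow_neg_le ha₀ ε hw
      _ = _ := by ring
  · filter_upwards [hae] with w hw
    have hcont : ContinuousAt (fun ε : ℝ =>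
        V w * Complex.exp (freq w * x) * (c * ((ε : ℂ) + freq w) ^ (-a : ℂ))) 0 :=
      continuousAt_const.mul (continuousAt_const.mul (ContinuousAt.cpow (by fun_prop)
        continuousAt_const (by simpa using freq_mem_slitPlane hw)))
    simpa using hcont.tendsto.mono_left nhdsWithin_le_nhds

lemma integral_rpow_mul_comp_sub (hV : HasSpectralDensity u V M) (hi : Integrable u) {a : ℝ}
    (ha₀ : 0 < a) (ha₁ : a < 1) (x : ℝ) :
    ((∫ t in Ioi (0 : ℝ), t ^ (a - 1) * u (x - t) : ℝ) : ℂ) =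
      ∫ w, V w * Complex.exp (freq w * x) * (Real.Gamma a * freq w ^ (-a : ℂ)) := by
  rw [← integral_complex_ofReal]
  refine tendsto_nhds_unique (tendsto_integral_cexp_neg_mul_mul
    (integrableOn_rpow_mul_comp_sub hV.abs_le hi ha₀ ha₁.le x).ofReal)
    ((hV.tendsto_integral_add_freq_cpow_neg ha₀.le ha₁ _ x).congr' ?_)
  filter_upwards [self_mem_nhdsWithin] with ε hε
  exact (hV.integral_cexp_neg_mul_rpow_mul_comp_sub ha₀ hε x).symm

end HasSpectralDensity

end FractionalIntegral

section RiemannLiouville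

variable {α : ℝ}

lemma natCeil_sub_pos (hα : ∀ k : ℕ, α ≠ k) : 0 < (⌈α⌉₊ : ℝ) - α :=
  sub_pos.mpr ((Nat.le_ceil α).lt_of_ne (hα _))

lemma natCeil_sub_lt_one (hα : 0 < α) : (⌈α⌉₊ : ℝ) - α < 1 := by
  linarith [Nat.ceil_lt_add_one hα.le]

lemma pow_natCeil_mul_cpow_sub (hα : 0 < α) (z : ℂ) :
    z ^ ⌈α⌉₊ * z ^ ((α - ⌈α⌉₊ : ℝ) : ℂ) = z ^ (α : ℂ) := by
  rcases eq_or_ne z 0 with rfl | hz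
  · simp [hα.ne', (Nat.ceil_pos.mpr hα).ne']
  · rw [← Complex.cpow_natCast, ← Complex.cpow_add _ _ hz]
    simp

lemma leftRLIntegral_eq_integral_Ioi (u : ℝ → ℝ) (x : ℝ) :
    leftRLIntegral α u x = ∫ t in Ioi (0 : ℝ), t ^ ((⌈α⌉₊ : ℝ) - α - 1) * u (x - t) := by
  rw [leftRLIntegral, ← (Measure.measurePreserving_sub_left volume x).setIntegral_preimage_emb
      (MeasurableEquiv.subLeft x).measurableEmbedding _ (Iio x)]
  simp

lemma integrableOn_Iio_comp_sub_mul_iff {f u : ℝ → ℝ} {x : ℝ} :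
    IntegrableOn (fun s : ℝ => f (x - s) * u s) (Iio x) ↔
      IntegrableOn (fun t : ℝ => f t * u (x - t)) (Ioi 0) := by
  rw [← (Measure.measurePreserving_sub_left volume x).integrableOn_comp_preimage
      (MeasurableEquiv.subLeft x).measurableEmbedding]
  simp [Function.comp_def]

lemma integral_exp_freq_eq_fourier (m : ℝ → ℂ) :
    (fun x : ℝ => ∫ w, m w * Complex.exp (freq w * x)) =
      FourierTransform.fourier fun w => m (-w) := by
  ext x
  rw [← fourierInv_eq_integral_freq, Real.fourierInv_eq_fourier_comp_neg]

lemma integrable_pow_smul_comp_neg {m : ℝ → ℂ} {k : ℕ} (hm : Integrable fun w => w ^ k • m w) :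
    Integrable fun w : ℝ => w ^ k • m (-w) := by
  convert! hm.comp_neg.const_mul ((-1 : ℂ) ^ k) using 2 with w
  simp only [Complex.real_smul]
  push_cast
  rw [← mul_assoc, ← mul_pow]
  simp

lemma contDiff_integral_exp_freq {m : ℝ → ℂ} {n : ℕ}
    (hm : ∀ k ≤ n, Integrable fun w : ℝ => w ^ k • m w) :
    ContDiff ℝ n fun x : ℝ => ∫ w, m w * Complex.exp (freq w * x) := by
  rw [integral_exp_freq_eq_fourier]
  refine Real.contDiff_fourier (N := n) fun k hk => ?_
  convert! (integrable_pow_smul_comp_neg (hm k (by exact_mod_cast hk))).norm using 2 with w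
  simp

lemma iteratedDeriv_integral_exp_freq {m : ℝ → ℂ} {n : ℕ}
    (hm : ∀ k ≤ n, Integrable fun w : ℝ => w ^ k • m w) :
    iteratedDeriv n (fun x : ℝ => ∫ w, m w * Complex.exp (freq w * x)) =
      fun x : ℝ => ∫ w, freq w ^ n * m w * Complex.exp (freq w * x) := by
  rw [integral_exp_freq_eq_fourier, integral_exp_freq_eq_fourier fun w => freq w ^ n * m w,
    Real.iteratedDeriv_fourier (N := n)
      (fun k hk => integrable_pow_smul_comp_neg (hm k (by exact_mod_cast hk))) le_rfl]
  congr 1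
  ext w
  simp [freq]

namespace HasSpectralDensity

variable {u : ℝ → ℝ} {V : ℝ → ℂ} {M : ℝ}

lemma integrableOn_leftRL_integrand (hV : HasSpectralDensity u V M) (hi : Integrable u)
    (hα₀ : 0 < α) (hα : ∀ k : ℕ, α ≠ k) (x : ℝ) :
    IntegrableOn (fun s : ℝ => (x - s) ^ ((⌈α⌉₊ : ℝ) - α - 1) * u s) (Iio x) :=
  integrableOn_Iio_comp_sub_mul_iff (f := fun t => t ^ ((⌈α⌉₊ : ℝ) - α - 1)).mpr
    (integrableOn_rpow_mul_comp_sub hV.abs_le hi (natCeil_sub_pos hα)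
      (natCeil_sub_lt_one hα₀).le x)

lemma integrable_pow_smul_mul_freq_cpow (hV : HasSpectralDensity u V M) {b : ℝ} (hb : -1 < b)
    (c : ℂ) {k : ℕ} (hk : k + b ≤ M) :
    Integrable fun w : ℝ => w ^ k • (c * (V w * freq w ^ (b : ℂ))) := by
  have hmul := (hV.integrable_mul_of_norm_le (s := k + b) (C := (2 * Real.pi) ^ b)
    (m := fun w => (w : ℂ) ^ k * freq w ^ (b : ℂ)) (by linarith [k.cast_nonneg (α := ℝ)]) hk
    (by fun_prop) fun w => ?_).const_mul c
  · convert! hmul using 2 with w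
    simp only [Complex.real_smul]
    push_cast
    ring
  · calc _ = (2 * Real.pi) ^ b * (|w| ^ (k : ℝ) * |w| ^ b) := by
          rw [norm_mul, norm_pow, Complex.norm_real, Real.norm_eq_abs, norm_freq_cpow,
            Real.rpow_natCast, mul_left_comm]
      _ ≤ _ := by
          gcongr
          exact Real.le_rpow_add (abs_nonneg w) _ _

lemma leftRLIntegral_eq (hV : HasSpectralDensity u V M) (hi : Integrable u) (hα₀ : 0 < α)
    (hα : ∀ k : ℕ, α ≠ k) (x : ℝ) :
    (leftRLIntegral α u x : ℂ) = ∫ w, Real.Gamma (⌈α⌉₊ - α) *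
      (V w * freq w ^ ((α - ⌈α⌉₊ : ℝ) : ℂ)) * Complex.exp (freq w * x) := by
  rw [leftRLIntegral_eq_integral_Ioi,
    hV.integral_rpow_mul_comp_sub hi (natCeil_sub_pos hα) (natCeil_sub_lt_one hα₀)]
  refine integral_congr_ae (Eventually.of_forall fun w => ?_)
  simp only
  push_cast
  rw [neg_sub]
  ring

lemma integrable_leftRLIntegral_multiplier (hV : HasSpectralDensity u V M) (hα₀ : 0 < α)
    (hαM : α ≤ M) (c : ℂ) (k : ℕ) (hk : k ≤ ⌈α⌉₊) :
    Integrable fun w : ℝ => w ^ k • (c * (V w * freq w ^ ((α - ⌈α⌉₊ : ℝ) : ℂ))) :=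
  hV.integrable_pow_smul_mul_freq_cpow (by linarith [natCeil_sub_lt_one hα₀]) c <| by
    have : (k : ℝ) ≤ ⌈α⌉₊ := by exact_mod_cast hk
    linarith

lemma contDiff_leftRLIntegral (hV : HasSpectralDensity u V M) (hi : Integrable u) (hα₀ : 0 < α)
    (hα : ∀ k : ℕ, α ≠ k) (hαM : α ≤ M) : ContDiff ℝ ⌈α⌉₊ (leftRLIntegral α u) := by
  have hcomplex : ContDiff ℝ ⌈α⌉₊ fun x => (leftRLIntegral α u x : ℂ) := by
    simp only [hV.leftRLIntegral_eq hi hα₀ hα]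
    exact contDiff_integral_exp_freq (hV.integrable_leftRLIntegral_multiplier hα₀ hαM _)
  exact Complex.reCLM.contDiff.comp hcomplex

lemma leftRL_eq_integral (hV : HasSpectralDensity u V M) (hi : Integrable u) (hα₀ : 0 < α)
    (hα : ∀ k : ℕ, α ≠ k) (hαM : α ≤ M) (x : ℝ) :
    (leftRL α u x : ℂ) = ∫ w, V w * (Complex.exp (freq w * x) * freq w ^ (α : ℂ)) := by
  have hΓ : (Real.Gamma (⌈α⌉₊ - α) : ℂ) ≠ 0 := by
    exact_mod_cast (Real.Gamma_pos_of_pos (natCeil_sub_pos hα)).ne'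
  have hderiv := congrFun
    (iteratedDeriv_ofReal_comp (hV.contDiff_leftRLIntegral hi hα₀ hα hαM)) x
  simp only [hV.leftRLIntegral_eq hi hα₀ hα, iteratedDeriv_integral_exp_freq
    (hV.integrable_leftRLIntegral_multiplier hα₀ hαM _)] at hderiv
  rw [leftRL, Complex.ofReal_mul, ← hderiv, ← integral_const_mul]
  refine integral_congr_ae (Eventually.of_forall fun w => ?_)
  simp only [← pow_natCeil_mul_cpow_sub hα₀ (freq w)]
  push_cast
  field_simp

end HasSpectralDensity

end RiemannLiouville

section SchemeError

variable {α h : ℝ}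

lemma norm_exp_intCast_mul_freq_mul (p : ℤ) (w h : ℝ) :
    ‖Complex.exp (p * (freq w * h))‖ = 1 := by
  simp [Complex.norm_exp, freq_re]

lemma norm_exp_neg_freq_mul (w h : ℝ) : ‖Complex.exp (-(freq w * h))‖ = 1 := by
  simp [Complex.norm_exp, freq_re]

lemma norm_one_sub_exp_neg_freq_mul_cpow_le (hα : 0 ≤ α) (w h : ℝ) :
    ‖(1 - Complex.exp (-(freq w * h))) ^ (α : ℂ)‖ ≤ 2 ^ α := by
  rw [Complex.norm_cpow_real]
  refine Real.rpow_le_rpow (norm_nonneg _) ((norm_sub_le _ _).trans ?_) hα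
  rw [norm_exp_neg_freq_mul, norm_one, one_add_one_eq_two]

lemma freq_cpow_eq_rpow_neg_mul (hα : α ≠ 0) (hh : 0 < h) (w : ℝ) :
    freq w ^ (α : ℂ) = (h ^ (-α) : ℝ) * (freq w * h) ^ (α : ℂ) := by
  rcases eq_or_ne (freq w) 0 with hw | hw
  · simp [hw, hα]
  · have hh₀ : (h : ℂ) ≠ 0 := Complex.ofReal_ne_zero.mpr hh.ne'
    rw [Complex.cpow_def_of_ne_zero (mul_ne_zero hw hh₀), Complex.log_mul_ofReal h hh _ hw,
      Complex.cpow_def_of_ne_zero hw, Real.rpow_def_of_pos hh, Complex.ofReal_exp,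
      ← Complex.exp_add]
    congr 1
    push_cast
    ring

lemma rpow_neg_mul_norm_freq_mul_rpow (hh : 0 < h) (q : ℕ) (w : ℝ) :
    h ^ (-α) * ‖freq w * h‖ ^ (q + α) = (2 * Real.pi) ^ (q + α) * |w| ^ (q + α) * h ^ q := by
  rw [norm_mul, norm_freq, Complex.norm_real, Real.norm_of_nonneg hh.le,
    Real.mul_rpow (by positivity) hh.le, Real.mul_rpow (by positivity) (abs_nonneg w),
    mul_left_comm, ← Real.rpow_add hh, neg_add_cancel_comm_assoc, Real.rpow_natCast]

namespace HasSpectralDensity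

variable {u : ℝ → ℝ} {V : ℝ → ℂ} {M : ℝ}

lemma summable_grunwaldTerm (hV : HasSpectralDensity u V M) (hα₀ : 0 < α)
    (hα : ∀ k : ℕ, α ≠ k) (h : ℝ) (p : ℤ) (x : ℝ) : Summable (grunwaldTerm α h p u x) := by
  refine ((summable_grunwaldWeight hα₀ hα).norm.mul_right (∫ w, ‖V w‖)).of_norm_bounded
    fun k => ?_
  rw [grunwaldTerm, norm_mul]
  gcongr
  exact hV.abs_le _

lemma tsum_grunwaldTerm_eq_integral (hV : HasSpectralDensity u V M) (hα₀ : 0 < α)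
    (hα : ∀ k : ℕ, α ≠ k) (h : ℝ) (p : ℤ) (x : ℝ) :
    ((∑' k, grunwaldTerm α h p u x k : ℝ) : ℂ) =
      ∫ w, V w * (Complex.exp (freq w * x) * (Complex.exp (p * (freq w * h)) *
        (1 - Complex.exp (-(freq w * h))) ^ (α : ℂ))) := by
  set F : ℕ → ℝ → ℂ := fun k w => (grunwaldWeight α k : ℂ) *
    (V w * Complex.exp (freq w * (x - (k - p) * h : ℝ))) with hF
  have hF_int (k : ℕ) : Integrable (F k) :=
    (hV.integrable.mul_bdd (c := 1) (Measurable.aestronglyMeasurable (by fun_prop))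
      (Eventually.of_forall fun w => (norm_exp_freq_mul _ _).le)).const_mul _
  have hF_norm (k : ℕ) : ∫ w, ‖F k w‖ = ‖grunwaldWeight α k‖ * ∫ w, ‖V w‖ := by
    simp only [hF, norm_mul, norm_exp_freq_mul, mul_one, Complex.norm_real, integral_const_mul]
  have hF_term (k : ℕ) : ∫ w, F k w = (grunwaldTerm α h p u x k : ℂ) := by
    rw [grunwaldTerm, Complex.ofReal_mul, hV.eq_integral, ← integral_const_mul]
  have hsum := hasSum_integral_of_summable_integral_norm hF_int (by
    simpa only [hF_norm] using (summable_grunwaldWeight hα₀ hα).norm.mul_right _)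
  simp only [hF_term] at hsum
  rw [Complex.ofReal_tsum, hsum.tsum_eq]
  refine integral_congr_ae (Eventually.of_forall fun w => ?_)
  simp only [← tsum_grunwaldWeight_mul_pow hα₀ hα (norm_exp_neg_freq_mul w h).le,
    ← tsum_mul_left]
  congr 1
  ext k
  simp only [hF, ← Complex.exp_nat_mul]
  push_cast
  rw [show freq w * (x - (k - p) * h : ℂ) =
    freq w * x + (p * (freq w * h) + k * -(freq w * h)) by ring, Complex.exp_add, Complex.exp_add]
  ring

lemma shiftedGrunwald_eq_integral (hV : HasSpectralDensity u V M) (hα₀ : 0 < α)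
    (hα : ∀ k : ℕ, α ≠ k) (hh : 0 < h) (p : ℤ) (x : ℝ) :
    (shiftedGrunwald α h p u x : ℂ) = ∫ w, V w * (Complex.exp (freq w * x) * ((h ^ (-α) : ℝ) *
      ((1 - Complex.exp (-(freq w * h))) ^ (α : ℂ) * Complex.exp (p * (freq w * h))))) := by
  rw [shiftedGrunwald, Complex.ofReal_mul, hV.tsum_grunwaldTerm_eq_integral hα₀ hα, one_div,
    ← Real.rpow_neg hh.le, ← integral_const_mul]
  refine integral_congr_ae (Eventually.of_forall fun w => ?_)
  ring

lemma leftRL_add_mul_eq_integral (hV : HasSpectralDensity u V M) (hi : Integrable u)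
    (hα₀ : 0 < α) (hα : ∀ k : ℕ, α ≠ k) (hαM : α ≤ M) (hh : 0 < h) (x c : ℝ) :
    (leftRL α u (x + c * h) : ℂ) = ∫ w, V w * (Complex.exp (freq w * x) * ((h ^ (-α) : ℝ) *
      ((freq w * h) ^ (α : ℂ) * Complex.exp (c * (freq w * h))))) := by
  rw [hV.leftRL_eq_integral hi hα₀ hα hαM]
  refine integral_congr_ae (Eventually.of_forall fun w => ?_)
  simp only [freq_cpow_eq_rpow_neg_mul hα₀.ne' hh w]
  push_cast
  rw [show freq w * (x + c * h : ℂ) = freq w * x + c * (freq w * h) by ring, Complex.exp_add]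
  ring

lemma integrable_grunwald_multiplier (hV : HasSpectralDensity u V M) (hα : 0 ≤ α)
    (h : ℝ) (p : ℤ) (x : ℝ) :
    Integrable fun w => V w * (Complex.exp (freq w * x) * ((h ^ (-α) : ℝ) *
      ((1 - Complex.exp (-(freq w * h))) ^ (α : ℂ) * Complex.exp (p * (freq w * h))))) := by
  refine hV.integrable_mul_of_norm_le (s := 0) (C := |h ^ (-α)| * 2 ^ α) neg_one_lt_zero
    hV.order_nonneg (by fun_prop) fun w => ?_
  rw [norm_mul, norm_mul, norm_mul, norm_exp_freq_mul, norm_exp_intCast_mul_freq_mul,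
    Complex.norm_real, Real.norm_eq_abs, Real.rpow_zero, one_mul, mul_one, mul_one]
  gcongr
  exact norm_one_sub_exp_neg_freq_mul_cpow_le hα w h

lemma integrable_leftRL_multiplier (hV : HasSpectralDensity u V M) (hα₀ : 0 < α) (hαM : α ≤ M)
    (hh : 0 < h) (x c : ℝ) :
    Integrable fun w => V w * (Complex.exp (freq w * x) * ((h ^ (-α) : ℝ) *
      ((freq w * h) ^ (α : ℂ) * Complex.exp (c * (freq w * h))))) := by
  refine hV.integrable_mul_of_norm_le (s := α) (C := (2 * Real.pi) ^ α) (by linarith) hαM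
    (by fun_prop) fun w => ?_
  rw [← mul_assoc (_ : ℂ) _ (Complex.exp (c * _)), ← freq_cpow_eq_rpow_neg_mul hα₀.ne' hh,
    norm_mul, norm_mul, norm_exp_freq_mul, norm_freq_cpow]
  simp [Complex.norm_exp, freq_re]

end HasSpectralDensity

namespace CompactScheme

variable {ι κ : Type*} [Fintype ι] [Fintype κ] (S : CompactScheme ι κ)

/-- The defect at `x` of the relation that the scheme `S` with step size `h` imposes between the
left Riemann-Liouville derivative and the shifted Grünwald-Letnikov operators of `u`. -/
def error (α h : ℝ) (u : ℝ → ℝ) (x : ℝ) : ℝ :=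
  ∑ j, S.derivWeight j * leftRL α u (x + S.derivNode j * h) -
    ∑ i, S.diffWeight i * shiftedGrunwald α h (S.diffShift i) u x

variable {S} {u : ℝ → ℝ} {V : ℝ → ℂ} {M : ℝ}

lemma error_eq_integral_symbol (hV : HasSpectralDensity u V M) (hi : Integrable u) (hα₀ : 0 < α)
    (hα : ∀ k : ℕ, α ≠ k) (hαM : α ≤ M) (hh : 0 < h) (x : ℝ) :
    (S.error α h u x : ℂ) = ∫ w, V w * (Complex.exp (freq w * x) *
      ((h ^ (-α) : ℝ) * S.symbol α (freq w * h))) := by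
  have hderiv (j : ι) := (hV.integrable_leftRL_multiplier hα₀ hαM hh x
    (S.derivNode j)).const_mul (S.derivWeight j : ℂ)
  have hdiff (i : κ) := (hV.integrable_grunwald_multiplier hα₀.le h
    (S.diffShift i) x).const_mul (S.diffWeight i : ℂ)
  rw [error]
  push_cast
  simp only [hV.leftRL_add_mul_eq_integral hi hα₀ hα hαM hh,
    hV.shiftedGrunwald_eq_integral hα₀ hα hh, ← integral_const_mul]
  rw [← integral_finsetSum _ fun j _ => hderiv j, ← integral_finsetSum _ fun i _ => hdiff i,
    ← integral_sub (integrable_finsetSum _ fun j _ => hderiv j)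
      (integrable_finsetSum _ fun i _ => hdiff i)]
  refine integral_congr_ae (Eventually.of_forall fun w => ?_)
  simp only [symbol, mul_sub, Finset.mul_sum]
  congr! 2 <;> ring

theorem MatchesMoments.exists_abs_error_le {q : ℕ} (hS : S.MatchesMoments α q)
    (hV : HasSpectralDensity u V M) (hi : Integrable u) (hα₀ : 0 < α) (hα : ∀ k : ℕ, α ≠ k)
    (hqM : q + α ≤ M) : ∃ C, ∀ h, 0 < h → ∀ x, |S.error α h u x| ≤ C * h ^ q := by
  obtain ⟨C, hC⟩ := hS.exists_norm_symbol_le hα₀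
  have hαM : α ≤ M := (le_add_of_nonneg_left q.cast_nonneg).trans hqM
  have hmoment := hV.integrable_abs_rpow_mul_norm (neg_one_lt_zero.trans (by positivity)) hqM
  refine ⟨∫ w, C * (2 * Real.pi) ^ (q + α) * (|w| ^ (q + α) * ‖V w‖), fun h hh x => ?_⟩
  rw [← Real.norm_eq_abs, ← Complex.norm_real,
    error_eq_integral_symbol hV hi hα₀ hα hαM hh, ← integral_mul_const]
  refine norm_integral_le_of_norm_le ((hmoment.const_mul _).mul_const _)
    (Eventually.of_forall fun w => ?_)
  rw [norm_mul, norm_mul, norm_mul, norm_exp_freq_mul, one_mul, Complex.norm_real,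
    Real.norm_of_nonneg (by positivity)]
  calc ‖V w‖ * (h ^ (-α) * ‖S.symbol α (freq w * h)‖)
      ≤ ‖V w‖ * (h ^ (-α) * (C * ‖freq w * h‖ ^ (q + α))) := by
        gcongr
        exact hC _ (by simp [freq_re])
    _ = C * ‖V w‖ * (h ^ (-α) * ‖freq w * h‖ ^ (q + α)) := by ring
    _ = _ := by
        rw [rpow_neg_mul_norm_freq_mul_rpow hh]
        ring

end CompactScheme

end SchemeError

section FifthOrderScheme

/-- The scheme of the theorem, which applies `fiveCWSGD` to the Riemann-Liouville derivative. -/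
def fifthOrderScheme (α : ℝ) : CompactScheme (Fin 3) (Fin 3) where
  derivWeight := ![gammaOne α, 1, gammaTwo α]
  derivNode := ![-1, 0, 1]
  diffWeight := ![muOne α, muZero α, muNegOne α]
  diffShift := ![1, 0, -1]

variable {α : ℝ}

lemma matchesMoments_fifthOrderScheme (hd : denom α ≠ 0) :
    (fifthOrderScheme α).MatchesMoments α 5 := fun l hl => by
  simpa [Fin.sum_univ_three, fifthOrderScheme, div_eq_mul_inv] using
    coefficientSystem_iff_forall_lt.mp (coefficientSystem_solution hd) l hl

lemma error_fifthOrderScheme (h : ℝ) (u : ℝ → ℝ) (x : ℝ) :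
    (fifthOrderScheme α).error α h u x = fiveCWSGD α h (leftRL α u) x -
      (muOne α * shiftedGrunwald α h 1 u x + muZero α * shiftedGrunwald α h 0 u x +
        muNegOne α * shiftedGrunwald α h (-1) u x) := by
  simp [CompactScheme.error, Fin.sum_univ_three, fifthOrderScheme, fiveCWSGD, sub_eq_add_neg]

lemma ne_natCast_of_one_lt_of_lt_two (h₁ : 1 < α) (h₂ : α < 2) (k : ℕ) : α ≠ k := by
  rintro rfl
  norm_cast at h₁ h₂
  omega

end FifthOrderScheme

end FifthOrderCWSGD

end

open FifthOrderCWSGD in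
theorem mainTheorem8_general (α : ℝ) (hα₀ : 0 < α) (hα : ∀ k : ℕ, α ≠ k) (hden : denom α ≠ 0) :
    (∀ g₁ g₂ m₁ m₀ m₂ : ℝ, CoefficientSystem α g₁ g₂ m₁ m₀ m₂ ↔
      g₁ = gammaOne α ∧ g₂ = gammaTwo α ∧ m₁ = muOne α ∧ m₀ = muZero α ∧ m₂ = muNegOne α) ∧
    ∀ (u : ℝ → ℝ) (N : ℕ), α + 6 < N → ContDiff ℝ N u →
      (∀ k : ℕ, k ≤ N → Integrable (iteratedDeriv k u)) →
      (∀ x : ℝ, IntegrableOn (fun s => (x - s) ^ ((⌈α⌉₊ : ℝ) - α - 1) * u s) (Iio x)) ∧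
      ContDiff ℝ ⌈α⌉₊ (leftRLIntegral α u) ∧
      (∀ (h : ℝ) (p : ℤ) (x : ℝ), Summable (grunwaldTerm α h p u x)) ∧
      ∃ C : ℝ, ∀ h : ℝ, 0 < h → ∀ x : ℝ,
        |fiveCWSGD α h (leftRL α u) x -
          (muOne α * shiftedGrunwald α h 1 u x + muZero α * shiftedGrunwald α h 0 u x +
            muNegOne α * shiftedGrunwald α h (-1) u x)| ≤ C * h ^ 5 := by
  refine ⟨coefficientSystem_iff hα₀.ne' hden, fun u N hN hu hint => ?_⟩
  have hi : Integrable u := by simpa using hint 0 N.zero_le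
  obtain ⟨V, hV⟩ := exists_hasSpectralDensity (M := (5 : ℕ) + α) (by positivity)
    (by push_cast; linarith) hu hint
  obtain ⟨C, hC⟩ :=
    (matchesMoments_fifthOrderScheme hden).exists_abs_error_le hV hi hα₀ hα le_rfl
  refine ⟨hV.integrableOn_leftRL_integrand hi hα₀ hα,
    hV.contDiff_leftRLIntegral hi hα₀ hα (le_add_of_nonneg_left (Nat.cast_nonneg 5)),
    hV.summable_grunwaldTerm hα₀ hα, C, fun h hh x => ?_⟩
  simpa only [error_fifthOrderScheme] using hC h hh x

theorem mainTheorem8 (α : ℝ) (hα₁ : 1 < α) (hα₂ : α < 2)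
    (hden : FifthOrderCWSGD.denom α ≠ 0) :
    (∀ g₁ g₂ m₁ m₀ m₂ : ℝ,
      FifthOrderCWSGD.CoefficientSystem α g₁ g₂ m₁ m₀ m₂ ↔
        g₁ = FifthOrderCWSGD.gammaOne α ∧ g₂ = FifthOrderCWSGD.gammaTwo α ∧
        m₁ = FifthOrderCWSGD.muOne α ∧ m₀ = FifthOrderCWSGD.muZero α ∧
        m₂ = FifthOrderCWSGD.muNegOne α) ∧
    ∀ u : ℝ → ℝ, ContDiff ℝ 8 u →
      (∀ k : ℕ, k ≤ 8 → MeasureTheory.Integrable (iteratedDeriv k u) MeasureTheory.volume) →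
      -- the fractional derivative and the Grünwald series are well defined
      (∀ x : ℝ, MeasureTheory.IntegrableOn
        (fun s : ℝ => (x - s) ^ ((⌈α⌉₊ : ℝ) - α - 1) * u s) (Set.Iio x)
        MeasureTheory.volume) ∧
      ContDiff ℝ (⌈α⌉₊ : ℕ) (FifthOrderCWSGD.leftRLIntegral α u) ∧
      (∀ h : ℝ, 0 < h → ∀ (p : ℤ) (x : ℝ),
        Summable (FifthOrderCWSGD.grunwaldTerm α h p u x)) ∧
      -- fifth order accuracy, uniformly in `x`
      ∃ C h₀ : ℝ, 0 < h₀ ∧ ∀ h : ℝ, 0 < h → h < h₀ → ∀ x : ℝ,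
        |FifthOrderCWSGD.fiveCWSGD α h (FifthOrderCWSGD.leftRL α u) x -
          (FifthOrderCWSGD.muOne α * FifthOrderCWSGD.shiftedGrunwald α h 1 u x +
            FifthOrderCWSGD.muZero α * FifthOrderCWSGD.shiftedGrunwald α h 0 u x +
            FifthOrderCWSGD.muNegOne α * FifthOrderCWSGD.shiftedGrunwald α h (-1) u x)|
          ≤ C * h ^ 5 := by
  obtain ⟨hsystem, hscheme⟩ := mainTheorem8_general α (by linarith)
    (FifthOrderCWSGD.ne_natCast_of_one_lt_of_lt_two hα₁ hα₂) hden
  refine ⟨hsystem, fun u hu hint => ?_⟩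
  obtain ⟨hIio, hcont, hsum, C, hC⟩ := hscheme u 8 (by norm_num; linarith) hu hint
  exact ⟨hIio, hcont, fun h _ => hsum h, C, 1, one_pos, fun h hh _ => hC h hh⟩
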